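/- Let $d\in\mathbb{N}$ and $\alpha>-1/2$. On $\mathbb{R}^{d+1}_+=\mathbb{R}^d\times(0,\infty)$, with points $x=(x',x_{d+1})$ and Euclidean length $|x|$, let $$d\mu_\alpha(x)=\frac{x_{d+1}^{2\alpha+1}}{(2\pi)^{d/2}\,2^{\alpha}\,\Gamma(\alpha+1)}\,dx,$$ and let $L^p_\alpha(\mathbb{R}^{d+1}_+)$, with norm $\|\cdot\|_{\alpha,p}$, be the complex $L^p$ space of $\mu_\alpha$. Let $$j_\alpha(r)=\Gamma(\alpha+1)\sum_{k=0}^\infty\frac{(-1)^k r^{2k}}{2^{2k}\,k!\,\Gamma(\alpha+k+1)},\qquad \Lambda^d_\alpha(x,\lambda)=e^{-i\langle x',\lambda'\rangle}j_\alpha(x_{d+1}\lambda_{d+1}).$$ The Weinstein transform of $\varphi\in L^1_\alpha(\mathbb{R}^{d+1}_+)$ is $\mathcal{F}_{W,\alpha}(\varphi)(\lambda)=\int_{\mathbb{R}^{d+1}_+}\varphi(x)\Lambda^d_\alpha(x,\lambda)\,d\mu_\alpha(x)$. Let $1<p\le 2$, $q=p/(p-1)$, $0<s<(2\alpha+d+2)/q$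 and $t>0$. Then there is a constant $K=K(s,t)>0$, depending only on $d,\alpha,p,s,t$, such that for every $\varphi\in L^p_\alpha(\mathbb{R}^{d+1}_+)$ the Weinstein transform $\mathcal{F}_{W,\alpha}(\varphi)\in L^q_\alpha(\mathbb{R}^{d+1}_+)$ is well defined as the extension by density from $L^1_\alpha\cap L^p_\alpha$ (there are $u_n\in L^1_\alpha\cap L^p_\alpha$ such that $u_n\to\varphi$ in $L^p_\alpha$ and $\mathcal{F}_{W,\alpha}(u_n)$ converges in $L^q_\alpha$, and the limit is, up to equality almost everywhere, the same for all such sequences), and $$\|\mathcal{F}_{W,\alpha}(\varphi)\|_{\alpha,q}\le K(s,t)\,\bigl\||x|^s\varphi\bigr\|_{\alpha,p}^{\frac{t}{s+t}}\,\bigl\||y|^t\mathcal{F}_{W,\alpha}(\varphi)\bigr\|_{\alpha,q}^{\frac{s}{s+t}},$$ where the norms on the right may be infinite (with $0\cdot\infty=0$). -/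

import Mathlib

open MeasureTheory Filter Topology

noncomputable section

/-- The ambient space `ℝ^d × ℝ` of the half space `ℝ^{d+1}_+ = ℝ^d × (0, ∞)`. A point is
`x = (x', x_{d+1})`; the half space is selected by the measure `weinsteinMeasure`. -/
abbrev WeinsteinSpace (d : ℕ) : Type := EuclideanSpace ℝ (Fin d) × ℝ

/-- The Euclidean length `|x| = (|x'|² + x_{d+1}²)^{1/2}`
(the norm instance of the product type is the maximum norm, and is not used). -/
def euclLength {d : ℕ} (x : WeinsteinSpace d) : ℝ :=
  Real.sqrt (‖x.1‖ ^ 2 + x.2 ^ 2)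

/-- The normalized Bessel function
`j_α(x) = Γ(α+1) ∑_k (-1)^k x^{2k} / (2^{2k} k! Γ(α+k+1))`. -/
def normalizedBessel (α x : ℝ) : ℝ :=
  Real.Gamma (α + 1) *
    ∑' k : ℕ, (-1) ^ k * x ^ (2 * k) /
      (2 ^ (2 * k) * (Nat.factorial k : ℝ) * Real.Gamma (α + (k : ℝ) + 1))

/-- The Weinstein kernel `Λ(x, l) = exp(-i ⟨x', l'⟩) j_α(x_{d+1} l_{d+1})`. -/
def weinsteinKernel {d : ℕ} (α : ℝ) (x l : WeinsteinSpace d) : ℂ :=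
  Complex.exp (-Complex.I * ((inner ℝ x.1 l.1 : ℝ) : ℂ)) *
    ((normalizedBessel α (x.2 * l.2) : ℝ) : ℂ)

/-- The measure `dμ_α(x) = x_{d+1}^{2α+1} / ((2π)^{d/2} 2^α Γ(α+1)) dx` on `ℝ^d × (0, ∞)`. -/
def weinsteinMeasure (d : ℕ) (α : ℝ) : Measure (WeinsteinSpace d) :=
  (volume.restrict {x : WeinsteinSpace d | 0 < x.2}).withDensity fun x =>
    ENNReal.ofReal (x.2 ^ (2 * α + 1) /
      ((2 * Real.pi) ^ ((d : ℝ) / 2) * 2 ^ α * Real.Gamma (α + 1)))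

/-- The Weinstein transform of an integrable function:
`l ↦ ∫ φ(x) Λ(x, l) dμ_α(x)`. -/
def weinsteinIntegral {d : ℕ} (α : ℝ) (φ : WeinsteinSpace d → ℂ) (l : WeinsteinSpace d) : ℂ :=
  ∫ x, φ x * weinsteinKernel α x l ∂(weinsteinMeasure d α)

/-- `ψ ∈ L^q` is the Weinstein transform of `φ ∈ L^p`, in the sense of the extension by density
from `L^1 ∩ L^p`: there are `u n ∈ L^1 ∩ L^p` with `u n → φ` in `L^p` whose (integral)
transforms converge to `ψ` in `L^q`. -/
def IsWeinsteinTransform {d : ℕ} (α p q : ℝ) (φ ψ : WeinsteinSpace d → ℂ) : Prop :=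
  MemLp φ (ENNReal.ofReal p) (weinsteinMeasure d α) ∧
  MemLp ψ (ENNReal.ofReal q) (weinsteinMeasure d α) ∧
  ∃ u : ℕ → WeinsteinSpace d → ℂ,
    (∀ n, MemLp (u n) 1 (weinsteinMeasure d α) ∧
      MemLp (u n) (ENNReal.ofReal p) (weinsteinMeasure d α)) ∧
    Tendsto (fun n => eLpNorm (fun x => u n x - φ x) (ENNReal.ofReal p) (weinsteinMeasure d α))
      atTop (𝓝 0) ∧
    Tendsto (fun n => eLpNorm (fun y => weinsteinIntegral α (u n) y - ψ y)
      (ENNReal.ofReal q) (weinsteinMeasure d α)) atTop (𝓝 0)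

end

/-! Put Q = 2α+d+2, the homogeneous dimension of `weinsteinMeasure`. For a radius ρ the frequency
side is cut at |y| = ρ. The part |y| > ρ costs ρ^(-t) times the weighted norm of the transform. For
|y| ≤ ρ the function is cut at the reciprocal radius |x| = 1/ρ. The transform of the inner piece is
bounded by the L¹ norm of that piece, hence by Hölder by ρ^(s-Q/q) ‖|x|^s φ‖_p, and the ball of
radius ρ has L^q size ρ^(Q/q); the outer piece goes through Hausdorff–Young after inserting (ρ|x|)^s
≥ 1. Both give ρ^s ‖|x|^s φ‖_p, and choosing ρ to balance ρ^s A against ρ^(-t) B yields the product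
of powers.

Hausdorff–Young, with a constant that need not be sharp, is Marcinkiewicz interpolation between L¹ →
L^∞ and L² → L². The first endpoint is |Λ| ≤ 1, which comes from a decreasing energy of Bessel's
equation (`abs_hypZeroOne_neg_le_one`). For the second, only ‖Fu‖₂ ≤ ‖u‖₂ is needed, not
Plancherel's identity: with a Gaussian weight inserted, the kernel of F* w F is the Weinstein heat
kernel, which is nonnegative and has mass one (`lintegral_enorm_heatKernel`); Schur's test bounds
the weighted norm, and Fatou's lemma removes the weight. The closed form of the heat kernel rests on
Weber's second exponential integral, obtained from a double power series and the Chu–Vandermonde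
identity.

Hausdorff–Young also supplies existence and uniqueness of the extension by density, and the
estimates pass from truncations of φ to the limit. -/

noncomputable section

/-! ### The series ₀F₁ and the bound on the Bessel function -/

/-- The confluent hypergeometric limit function `₀F₁(β; z) = ∑_k z^k / (k! (β)_k)`. -/
def hypZeroOne (β z : ℝ) : ℝ :=
  ∑' k : ℕ, z ^ k / ((k.factorial : ℝ) * (ascPochhammer ℝ k).eval β)

theorem ascPochhammer_eval_succ_left (β : ℝ) (k : ℕ) :
    (ascPochhammer ℝ (k + 1)).eval β = β * (ascPochhammer ℝ k).eval (β + 1) := by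
  simp [ascPochhammer_succ_left]

theorem ascPochhammer_eval_add (β : ℝ) (k j : ℕ) :
    (ascPochhammer ℝ (k + j)).eval β =
      (ascPochhammer ℝ k).eval β * (ascPochhammer ℝ j).eval (β + k) := by
  rw [← ascPochhammer_mul]; simp

theorem gamma_add_nat (β : ℝ) (hβ : 0 < β) (k : ℕ) :
    Real.Gamma (β + k) = (ascPochhammer ℝ k).eval β * Real.Gamma β := by
  induction k with
  | zero => simp
  | succ k ih =>
    rw [ascPochhammer_succ_eval, Nat.cast_succ, ← add_assoc, Real.Gamma_add_one (by positivity), ih]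
    ring

/-- Every factor of (β)_k after the first is at least 1. The bound is uniform in k, so the
exponential series dominates ₀F₁. -/
theorem min_one_le_ascPochhammer_eval (β : ℝ) (hβ : 0 < β) (k : ℕ) :
    min 1 β ≤ (ascPochhammer ℝ k).eval β := by
  cases k with
  | zero => simp
  | succ k =>
    induction k with
    | zero => simp
    | succ k ih =>
      rw [ascPochhammer_succ_eval]
      have h1 : (1 : ℝ) ≤ β + ((k + 1 : ℕ) : ℝ) := by
        push_cast
        have : (0 : ℝ) ≤ k := by positivity
        linarith
      exact ih.trans (le_mul_of_one_le_right (ascPochhammer_pos _ _ hβ).le h1)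

theorem norm_hypZeroOne_term_le (β : ℝ) (hβ : 0 < β) {z R : ℝ} (hz : |z| ≤ R) (k : ℕ) :
    ‖z ^ k / ((k.factorial : ℝ) * (ascPochhammer ℝ k).eval β)‖ ≤
      (min 1 β)⁻¹ * (R ^ k / (k.factorial : ℝ)) := by
  have h0 : 0 < min 1 β := lt_min one_pos hβ
  have h1 := ascPochhammer_pos k β hβ
  rw [norm_div, norm_pow, Real.norm_eq_abs, Real.norm_of_nonneg (by positivity), inv_mul_eq_div,
    div_div]
  have hR : 0 ≤ R := (abs_nonneg z).trans hz
  have := min_one_le_ascPochhammer_eval β hβ k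
  gcongr

theorem summable_hypZeroOne (β : ℝ) (hβ : 0 < β) (z : ℝ) :
    Summable fun k : ℕ => z ^ k / ((k.factorial : ℝ) * (ascPochhammer ℝ k).eval β) :=
  Summable.of_norm_bounded ((Real.summable_pow_div_factorial |z|).mul_left _)
    (norm_hypZeroOne_term_le β hβ le_rfl)

theorem hypZeroOne_zero (β : ℝ) : hypZeroOne β 0 = 1 := by
  rw [hypZeroOne, tsum_eq_single 0]
  · simp
  · intro k hk
    simp [hk]

/-- Termwise differentiation shifts the index, and (β)_{k+1} = β (β+1)_k turns the shifted series
into one with parameter β+1. -/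
theorem hasDerivAt_hypZeroOne (β : ℝ) (hβ : 0 < β) (z : ℝ) :
    HasDerivAt (hypZeroOne β) (hypZeroOne (β + 1) z / β) z := by
  set R : ℝ := |z| + 1
  have hshift : ∀ (y : ℝ) (k : ℕ), ((k + 1 : ℕ) : ℝ) * y ^ k /
      (((k + 1).factorial : ℝ) * (ascPochhammer ℝ (k + 1)).eval β) =
      y ^ k / ((k.factorial : ℝ) * (ascPochhammer ℝ k).eval (β + 1)) / β := by
    intro y k
    have := (ascPochhammer_pos k (β + 1) (by positivity)).ne'
    rw [ascPochhammer_eval_succ_left, Nat.factorial_succ]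
    push_cast
    field_simp
  have hbd : ∀ (k : ℕ) (y : ℝ), y ∈ Metric.ball (0 : ℝ) R →
      ‖(k : ℝ) * y ^ (k - 1) / ((k.factorial : ℝ) * (ascPochhammer ℝ k).eval β)‖ ≤
      (k : ℝ) * R ^ (k - 1) / ((k.factorial : ℝ) * (ascPochhammer ℝ k).eval β) := by
    intro k y hy
    have h1 := ascPochhammer_pos k β hβ
    rw [mem_ball_zero_iff] at hy
    rw [norm_div, norm_mul, norm_pow, Real.norm_of_nonneg (by positivity : (0 : ℝ) ≤ k),
      Real.norm_of_nonneg (by positivity : (0 : ℝ) ≤ (k.factorial : ℝ) * _)]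
    gcongr
  have hsum : Summable fun k : ℕ =>
      (k : ℝ) * R ^ (k - 1) / ((k.factorial : ℝ) * (ascPochhammer ℝ k).eval β) := by
    rw [← summable_nat_add_iff 1]
    simp only [Nat.add_sub_cancel, hshift]
    exact (summable_hypZeroOne (β + 1) (by positivity) R).div_const β
  have hd := hasDerivAt_tsum_of_isPreconnected (𝕜 := ℝ)
    (g := fun (k : ℕ) (y : ℝ) => y ^ k / ((k.factorial : ℝ) * (ascPochhammer ℝ k).eval β))
    (y₀ := (0 : ℝ)) (y := z) hsum
    Metric.isOpen_ball (convex_ball (0 : ℝ) R).isPreconnected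
    (fun k y _ => (hasDerivAt_pow k y).div_const _) hbd
    (Metric.mem_ball_self (by positivity)) (summable_hypZeroOne β hβ 0)
    (by simp [R])
  refine HasDerivAt.congr_deriv hd ?_
  rw [← Summable.sum_add_tsum_nat_add 1
    (Summable.of_norm_bounded hsum fun k => hbd k z (by simp [R]))]
  simp only [Nat.add_sub_cancel, hshift, Finset.range_one, Finset.sum_singleton,
    tsum_div_const, hypZeroOne]
  simp

theorem continuous_hypZeroOne (β : ℝ) (hβ : 0 < β) : Continuous (hypZeroOne β) :=
  continuous_iff_continuousAt.2 fun z => (hasDerivAt_hypZeroOne β hβ z).continuousAt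

/-- Since F' and F'' are the series with parameters β+1 and β+2, divided by β and β(β+1), this is
the differential equation z F'' + β F' = F. -/
theorem hypZeroOne_contiguous (β : ℝ) (hβ : 0 < β) (z : ℝ) :
    z * hypZeroOne (β + 2) z / (β * (β + 1)) + hypZeroOne (β + 1) z = hypZeroOne β z := by
  have h0 := summable_hypZeroOne β hβ z
  have h1 := summable_hypZeroOne (β + 1) (by positivity) z
  have h2 := summable_hypZeroOne (β + 2) (by positivity) z
  have hterm : ∀ k : ℕ,
      z ^ (k + 1) / (((k + 1).factorial : ℝ) * (ascPochhammer ℝ (k + 1)).eval β) =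
      z ^ (k + 1) / (((k + 1).factorial : ℝ) * (ascPochhammer ℝ (k + 1)).eval (β + 1)) +
      z * (z ^ k / ((k.factorial : ℝ) * (ascPochhammer ℝ k).eval (β + 2))) / (β * (β + 1)) := by
    intro k
    have hp := ascPochhammer_pos k (β + 1 + 1) (by positivity)
    have hp1 := ascPochhammer_pos k (β + 1) (by positivity)
    have e1 : (ascPochhammer ℝ k).eval (β + 1) * (β + 1 + k) =
        (β + 1) * (ascPochhammer ℝ k).eval (β + 1 + 1) := by
      rw [← ascPochhammer_succ_eval, ascPochhammer_eval_succ_left]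
    have e2 : β + 2 = β + 1 + 1 := by ring
    have hk : 0 < β + 1 + (k : ℝ) := by positivity
    have e3 : (ascPochhammer ℝ k).eval (β + 1) =
        (β + 1) * (ascPochhammer ℝ k).eval (β + 1 + 1) / (β + 1 + k) := by
      rw [← e1]; field_simp
    rw [ascPochhammer_eval_succ_left, ascPochhammer_eval_succ_left, e2, e3, Nat.factorial_succ]
    push_cast
    field_simp
    ring
  rw [hypZeroOne, hypZeroOne, hypZeroOne, h0.tsum_eq_zero_add, h1.tsum_eq_zero_add]
  simp only [hterm]
  rw [Summable.tsum_add ((summable_nat_add_iff 1).2 h1) ((h2.mul_left _).div_const _),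
    tsum_div_const, tsum_mul_left]
  simp
  ring

/-- Along g(w) = ₀F₁(β; -w), which solves w g'' + β g' + g = 0, the energy w g'² + g² has derivative
(1 - 2β) g'² ≤ 0 and starts at 1. This is where α ≥ -1/2 enters. -/
theorem abs_hypZeroOne_neg_le_one (β : ℝ) (hβ : 1 / 2 ≤ β) (w : ℝ) (hw : 0 ≤ w) :
    |hypZeroOne β (-w)| ≤ 1 := by
  have hβ0 : 0 < β := by linarith
  set g : ℝ → ℝ := fun w => hypZeroOne β (-w)
  set g1 : ℝ → ℝ := fun w => -(hypZeroOne (β + 1) (-w) / β)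
  set g2 : ℝ → ℝ := fun w => hypZeroOne (β + 2) (-w) / (β * (β + 1))
  have hg : ∀ w, HasDerivAt g (g1 w) w := by
    intro w
    have := (hasDerivAt_hypZeroOne β hβ0 (-w)).comp w (hasDerivAt_neg w)
    exact this.congr_deriv (by simp [g1])
  have hg1 : ∀ w, HasDerivAt g1 (g2 w) w := by
    intro w
    have := (((hasDerivAt_hypZeroOne (β + 1) (by positivity) (-w)).comp w
      (hasDerivAt_neg w)).div_const β).neg
    refine this.congr_deriv ?_
    simp only [g2]
    rw [show β + 1 + 1 = β + 2 by ring]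
    field_simp
  have hode : ∀ w, w * g2 w + β * g1 w + g w = 0 := by
    intro w
    have := hypZeroOne_contiguous β hβ0 (-w)
    simp only [g, g1, g2]
    rw [← this]
    field_simp
    ring
  have hE : ∀ w, HasDerivAt (fun w => w * g1 w ^ 2 + g w ^ 2) ((1 - 2 * β) * g1 w ^ 2) w := by
    intro w
    refine (((hasDerivAt_id w).mul ((hg1 w).pow 2)).add ((hg w).pow 2)).congr_deriv ?_
    simp only [id, Nat.cast_ofNat, Pi.pow_apply]
    linear_combination 2 * g1 w * hode w
  have hanti : Antitone (fun w => w * g1 w ^ 2 + g w ^ 2) := by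
    apply antitone_of_deriv_nonpos
    · exact fun w => (hE w).differentiableAt
    · intro w
      rw [(hE w).deriv]
      nlinarith [sq_nonneg (g1 w)]
  have h := hanti hw
  simp only [zero_mul, zero_add] at h
  have h0 : g 0 = 1 := by simp [g, hypZeroOne_zero]
  rw [h0] at h
  have : g w ^ 2 ≤ 1 := by nlinarith [mul_nonneg hw (sq_nonneg (g1 w))]
  exact (sq_le_one_iff_abs_le_one _).1 this

theorem normalizedBessel_eq (α : ℝ) (hα : -1 < α) (x : ℝ) :
    normalizedBessel α x = hypZeroOne (α + 1) (-(x ^ 2 / 4)) := by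
  have hβ : 0 < α + 1 := by linarith
  have hG := Real.Gamma_pos_of_pos hβ
  rw [normalizedBessel, hypZeroOne, ← tsum_mul_left]
  congr 1
  funext k
  have hp := ascPochhammer_pos k (α + 1) hβ
  rw [show α + (k : ℝ) + 1 = α + 1 + k by ring, gamma_add_nat _ hβ, neg_pow (x ^ 2 / 4), div_pow, ← pow_mul,
    show (4 : ℝ) = 2 ^ 2 by norm_num, ← pow_mul]
  field_simp

/-! ### Chu–Vandermonde and Weber's double series -/

/-- A Chu–Vandermonde identity. After Pascal's rule the two terms at index k share a factor, and (β
+ k) + (n - k) = β + n comes out of the sum, leaving the identity for m with β + 1. -/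
theorem sum_choose_mul_descFactorial_mul_ascPochhammer (β : ℝ) (n m : ℕ) :
    ∑ kj ∈ Finset.HasAntidiagonal.antidiagonal m, (m.choose kj.1 : ℝ) *
      ((n.descFactorial kj.1 : ℝ) * (ascPochhammer ℝ kj.2).eval (β + kj.1)) =
    (ascPochhammer ℝ m).eval (β + n) := by
  induction m generalizing β with
  | zero => simp
  | succ m ih =>
    rw [Finset.sum_antidiagonal_choose_succ_mul
      (fun k j => (n.descFactorial k : ℝ) * (ascPochhammer ℝ j).eval (β + k)),
      ← Finset.sum_add_distrib, ascPochhammer_eval_succ_left,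
      show β + n + 1 = (β + 1) + n by ring, ← ih, Finset.mul_sum]
    refine Finset.sum_congr rfl fun kj hkj => ?_
    obtain ⟨k, j⟩ := kj
    have hm : k + j = m := by simpa using hkj
    have hc : m.choose j = m.choose k := by
      rw [← hm]; exact (Nat.choose_symm_add).symm
    simp only [hc]
    rw [ascPochhammer_eval_succ_left, Nat.descFactorial_succ]
    push_cast
    rw [show β + (k + 1) = β + k + 1 by ring, show β + 1 + k = β + k + 1 by ring]
    -- For k > n the truncated difference n - k is harmless, because the falling factorial vanishes.
    rcases le_or_gt k n with h | h
    · push_cast [Nat.cast_sub h]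
      ring
    · simp [Nat.descFactorial_of_lt h]

/-- The left side is the coefficient of a^m b^n in e^a e^b ₀F₁(β; ab); the identity is
Chu–Vandermonde divided by factorials. -/
theorem sum_inv_factorial_mul_ascPochhammer (β : ℝ) (hβ : 0 < β) (m n : ℕ) :
    ∑ k ∈ Finset.range (min m n + 1), 1 / (((m - k).factorial : ℝ) * ((n - k).factorial : ℝ) *
      ((k.factorial : ℝ) * (ascPochhammer ℝ k).eval β)) =
    (ascPochhammer ℝ (m + n)).eval β / ((m.factorial : ℝ) * (n.factorial : ℝ) *
      (ascPochhammer ℝ m).eval β * (ascPochhammer ℝ n).eval β) := by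
  have hm := (ascPochhammer_pos m β hβ).ne'
  have hn := (ascPochhammer_pos n β hβ).ne'
  have hV := sum_choose_mul_descFactorial_mul_ascPochhammer β n m
  rw [Finset.Nat.sum_antidiagonal_eq_sum_range_succ_mk] at hV
  rw [add_comm m n, ascPochhammer_eval_add, ← hV]
  have hsub : Finset.range (min m n + 1) ⊆ Finset.range m.succ := by
    apply Finset.range_subset_range.2
    have := min_le_left m n
    omega
  rw [← Finset.sum_subset hsub]
  · rw [Finset.mul_sum, Finset.sum_div]
    refine Finset.sum_congr rfl fun k hk => ?_
    have hk' : k ≤ min m n := by simpa [Nat.lt_succ_iff] using hk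
    have hkm : k ≤ m := hk'.trans (min_le_left _ _)
    have hkn : k ≤ n := hk'.trans (min_le_right _ _)
    have e1 : (m.choose k : ℝ) * (k.factorial * (m - k).factorial) = m.factorial := by
      rw [← mul_assoc]; exact_mod_cast Nat.choose_mul_factorial_mul_factorial hkm
    have e2 : ((n - k).factorial : ℝ) * n.descFactorial k = n.factorial := by
      exact_mod_cast Nat.factorial_mul_descFactorial hkn
    have e3 : (ascPochhammer ℝ m).eval β =
        (ascPochhammer ℝ k).eval β * (ascPochhammer ℝ (m - k)).eval (β + k) := by
      rw [← ascPochhammer_eval_add, Nat.add_sub_cancel' hkm]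
    have hk0 := (ascPochhammer_pos k β hβ).ne'
    have hj0 := (ascPochhammer_pos (m - k) (β + k) (by positivity)).ne'
    have hc : (m.choose k : ℝ) ≠ 0 := by exact_mod_cast (Nat.choose_pos hkm).ne'
    have hd : (n.descFactorial k : ℝ) ≠ 0 := by
      exact_mod_cast (Nat.descFactorial_pos.2 hkn).ne'
    rw [e3, ← e1, ← e2]
    field_simp
  · intro k hk hk'
    have h1 : k ≤ m := by simpa [Nat.lt_succ_iff] using hk
    have h2 : n < k := by
      simp only [Finset.mem_range, not_lt] at hk'
      rcases le_total m n with h | h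
      · rw [min_eq_left h] at hk'; omega
      · rw [min_eq_right h] at hk'; omega
    simp [Nat.descFactorial_of_lt h2]

/-- The double series `∑_{m,n} a^m b^n (β)_{m+n} / (m! n! (β)_m (β)_n) = e^{a+b} ₀F₁(β; ab)`
behind Weber's second exponential integral. -/
theorem hasSum_weber (β : ℝ) (hβ : 0 < β) (a b : ℝ) :
    HasSum (fun mn : ℕ × ℕ => a ^ mn.1 * b ^ mn.2 * ((ascPochhammer ℝ (mn.1 + mn.2)).eval β /
      ((mn.1.factorial : ℝ) * (mn.2.factorial : ℝ) *
      (ascPochhammer ℝ mn.1).eval β * (ascPochhammer ℝ mn.2).eval β)))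
      (Real.exp a * Real.exp b * hypZeroOne β (a * b)) := by
  have hexp : ∀ x : ℝ, HasSum (fun k : ℕ => x ^ k / (k.factorial : ℝ)) (Real.exp x) := by
    intro x
    rw [Real.exp_eq_exp_ℝ]
    exact NormedSpace.expSeries_div_hasSum_exp x
  have hsab := (Real.summable_pow_div_factorial a).norm.mul_norm
    (Real.summable_pow_div_factorial b).norm
  have h2 := (hexp a).mul (hexp b) hsab.of_norm
  have hh := (summable_hypZeroOne β hβ (a * b))
  have h3 := h2.mul hh.hasSum (hsab.mul_norm hh.norm).of_norm
  -- The absolutely convergent triple series in (i, j, k) is regrouped by the total exponents (i+k,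
  -- j+k) of a and b; each fibre is finite, indexed by k ≤ min m n.
  have h4 := h3.tsum_fiberwise
    (fun x : (ℕ × ℕ) × ℕ => (x.1.1 + x.2, x.1.2 + x.2))
  rw [hypZeroOne]
  refine h4.congr_fun fun mn => ?_
  obtain ⟨m, n⟩ := mn
  have hfib : (fun x : (ℕ × ℕ) × ℕ => (x.1.1 + x.2, x.1.2 + x.2)) ⁻¹' {(m, n)} =
      ↑((Finset.range (min m n + 1)).image fun k => (((m - k, n - k), k) : (ℕ × ℕ) × ℕ)) := by
    ext ⟨⟨i, j⟩, k⟩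
    simp only [Set.mem_preimage, Set.mem_singleton_iff, Prod.mk.injEq, Finset.coe_image,
      Set.mem_image, Finset.mem_coe, Finset.mem_range]
    constructor
    · rintro ⟨h, h'⟩
      refine ⟨k, by omega, by omega, rfl⟩
    · rintro ⟨k', hk', ⟨h1, h2⟩, rfl⟩
      omega
  rw [hfib, Finset.tsum_subtype' _ (fun x : (ℕ × ℕ) × ℕ => a ^ x.1.1 / (x.1.1.factorial : ℝ) *
    (b ^ x.1.2 / (x.1.2.factorial : ℝ)) *
    ((a * b) ^ x.2 / ((x.2.factorial : ℝ) * (ascPochhammer ℝ x.2).eval β))),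
    Finset.sum_image (by intro k _ k' _ h; simpa using (congrArg Prod.snd h)),
    ← sum_inv_factorial_mul_ascPochhammer β hβ m n, Finset.mul_sum]
  refine Finset.sum_congr rfl fun k hk => ?_
  have hkm : k ≤ m ∧ k ≤ n := by
    simp only [Finset.mem_range] at hk; omega
  obtain ⟨i, rfl⟩ := Nat.exists_eq_add_of_le hkm.1
  obtain ⟨j, rfl⟩ := Nat.exists_eq_add_of_le hkm.2
  have hk0 := (ascPochhammer_pos k β hβ).ne'
  simp only [Nat.add_sub_cancel_left]
  field_simp
  ring

/-! ### The radial measure and Weber's integral -/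

/-- The measure `x^{2α+1} / c dx` on `(0, ∞)`. -/
def besselMeasure (c α : ℝ) : Measure ℝ :=
  (volume.restrict (Set.Ioi 0)).withDensity fun x => ENNReal.ofReal (x ^ (2 * α + 1) / c)

/-- The constant `(2π)^{d/2} 2^α Γ(α+1)`. -/
def weinsteinConst (d : ℕ) (α : ℝ) : ℝ :=
  (2 * Real.pi) ^ ((d : ℝ) / 2) * 2 ^ α * Real.Gamma (α + 1)

theorem weinsteinConst_pos (d : ℕ) {α : ℝ} (hα : -1 < α) : 0 < weinsteinConst d α := by
  have := Real.Gamma_pos_of_pos (show 0 < α + 1 by linarith)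
  unfold weinsteinConst
  positivity

theorem measurable_besselDensity (c α : ℝ) :
    Measurable fun x : ℝ => ENNReal.ofReal (x ^ (2 * α + 1) / c) := by fun_prop

instance sfinite_besselMeasure (c α : ℝ) : SFinite (besselMeasure c α) := by
  unfold besselMeasure; infer_instance

theorem weinsteinMeasure_eq_prod (d : ℕ) (α : ℝ) :
    weinsteinMeasure d α = (volume : Measure (EuclideanSpace ℝ (Fin d))).prod
      (besselMeasure (weinsteinConst d α) α) := by
  rw [besselMeasure, prod_withDensity_right (measurable_besselDensity _ _), weinsteinMeasure]
  congr 1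
  have : {x : WeinsteinSpace d | 0 < x.2} = Set.univ ×ˢ Set.Ioi 0 := by
    ext x; simp
  rw [this, Measure.volume_eq_prod, ← Measure.prod_restrict, Measure.restrict_univ]

instance sfinite_weinsteinMeasure (d : ℕ) (α : ℝ) : SFinite (weinsteinMeasure d α) := by
  rw [weinsteinMeasure_eq_prod]; infer_instance

theorem lintegral_besselMeasure (c α : ℝ) (f : ℝ → ENNReal) :
    ∫⁻ x, f x ∂besselMeasure c α =
      ∫⁻ x in Set.Ioi 0, ENNReal.ofReal (x ^ (2 * α + 1) / c) * f x := by
  rw [besselMeasure, lintegral_withDensity_eq_lintegral_mul_non_measurable _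
    (measurable_besselDensity c α) (ae_of_all _ fun _ => ENNReal.ofReal_lt_top)]
  rfl

theorem lintegral_moment_besselMeasure {c α ε : ℝ} (hc : 0 < c) (hα : -1 < α) (hε : 0 < ε)
    (k : ℕ) :
    ∫⁻ x, ENNReal.ofReal (Real.exp (-(ε * x ^ 2)) * x ^ (2 * k)) ∂besselMeasure c α =
      ENNReal.ofReal ((ascPochhammer ℝ k).eval (α + 1) * Real.Gamma (α + 1) /
        (2 * c * ε ^ (α + 1 + k))) := by
  have hk : (0 : ℝ) ≤ k := by positivity
  have hint : IntegrableOn (fun x : ℝ => x ^ (2 * α + 1 + 2 * k) * Real.exp (-ε * x ^ (2 : ℝ)))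
      (Set.Ioi 0) :=
    integrableOn_rpow_mul_exp_neg_mul_rpow (by linarith) (by norm_num) hε
  rw [lintegral_besselMeasure]
  have heq : ∀ x ∈ Set.Ioi (0 : ℝ), ENNReal.ofReal (x ^ (2 * α + 1) / c) *
      ENNReal.ofReal (Real.exp (-(ε * x ^ 2)) * x ^ (2 * k)) =
      ENNReal.ofReal (c⁻¹ * (x ^ (2 * α + 1 + 2 * k) * Real.exp (-ε * x ^ (2 : ℝ)))) := by
    intro x hx
    have hx : 0 < x := hx
    rw [← ENNReal.ofReal_mul (by positivity), Real.rpow_add hx (2 * α + 1)]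
    congr 1
    rw [show (2 : ℝ) * k = ((2 * k : ℕ) : ℝ) by push_cast; ring, Real.rpow_natCast, Real.rpow_two,
      neg_mul]
    ring
  rw [setLIntegral_congr_fun measurableSet_Ioi heq, ← ofReal_integral_eq_lintegral_ofReal
    (hint.const_mul c⁻¹)]
  · rw [integral_const_mul, integral_rpow_mul_exp_neg_mul_rpow (by norm_num) (by linarith) hε]
    rw [show (2 * α + 1 + 2 * (k : ℝ) + 1) / 2 = α + 1 + k by ring,
      gamma_add_nat _ (by linarith),
      show -(2 * α + 1 + 2 * (k : ℝ) + 1) / 2 = -(α + 1 + k) by ring, Real.rpow_neg hε.le]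
    congr 1
    field_simp
  · filter_upwards [ae_restrict_mem measurableSet_Ioi] with x hx
    have hx : 0 < x := hx
    positivity

theorem integrable_moment_besselMeasure {c α ε : ℝ} (hc : 0 < c) (hα : -1 < α) (hε : 0 < ε)
    (k : ℕ) :
    Integrable (fun x => Real.exp (-(ε * x ^ 2)) * x ^ (2 * k)) (besselMeasure c α) := by
  refine ⟨by fun_prop, ?_⟩
  rw [hasFiniteIntegral_iff_ofReal (ae_of_all _ fun x => by
    have := (even_two_mul k).pow_nonneg x; simp only [Pi.zero_apply]; positivity)]
  rw [lintegral_moment_besselMeasure hc hα hε]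
  exact ENNReal.ofReal_lt_top

theorem integral_moment_besselMeasure {c α ε : ℝ} (hc : 0 < c) (hα : -1 < α) (hε : 0 < ε)
    (k : ℕ) :
    ∫ x, Real.exp (-(ε * x ^ 2)) * x ^ (2 * k) ∂besselMeasure c α =
      (ascPochhammer ℝ k).eval (α + 1) * Real.Gamma (α + 1) / (2 * c * ε ^ (α + 1 + k)) := by
  have hG := Real.Gamma_pos_of_pos (show 0 < α + 1 by linarith)
  have hp := ascPochhammer_pos k (α + 1) (by linarith)
  rw [integral_eq_lintegral_of_nonneg_ae (ae_of_all _ fun x => by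
    have := (even_two_mul k).pow_nonneg x; simp only [Pi.zero_apply]; positivity) (by fun_prop),
    lintegral_moment_besselMeasure hc hα hε, ENNReal.toReal_ofReal (by positivity)]

/-- Weber's second exponential integral. -/
theorem integral_exp_mul_normalizedBessel_mul {c α ε : ℝ} (hc : 0 < c) (hα : -1 < α) (hε : 0 < ε)
    (x y : ℝ) :
    ∫ l, Real.exp (-(ε * l ^ 2)) * (normalizedBessel α (x * l) * normalizedBessel α (y * l))
      ∂besselMeasure c α =
    Real.Gamma (α + 1) / (2 * c * ε ^ (α + 1)) *
      (Real.exp (-(x ^ 2 / (4 * ε))) * Real.exp (-(y ^ 2 / (4 * ε))) *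
        hypZeroOne (α + 1) (x ^ 2 / (4 * ε) * (y ^ 2 / (4 * ε)))) := by
  have hβ : 0 < α + 1 := by linarith
  have hG := Real.Gamma_pos_of_pos hβ
  set C : ℝ := Real.Gamma (α + 1) / (2 * c * ε ^ (α + 1)) with hC
  let D : ℕ × ℕ → ℝ := fun mn => (mn.1.factorial : ℝ) * (mn.2.factorial : ℝ) *
      (ascPochhammer ℝ mn.1).eval (α + 1) * (ascPochhammer ℝ mn.2).eval (α + 1)
  have hD : ∀ mn, 0 < D mn := fun mn => by
    have h1 := ascPochhammer_pos mn.1 (α + 1) hβ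
    have h2 := ascPochhammer_pos mn.2 (α + 1) hβ
    positivity
  let F : ℕ × ℕ → ℝ → ℝ := fun mn l => (-(x ^ 2 / 4)) ^ mn.1 * (-(y ^ 2 / 4)) ^ mn.2 / D mn *
    (Real.exp (-(ε * l ^ 2)) * l ^ (2 * (mn.1 + mn.2)))
  have hFint : ∀ mn, Integrable (F mn) (besselMeasure c α) := fun mn =>
    (integrable_moment_besselMeasure hc hα hε _).const_mul _
  have hpow : ∀ k : ℕ, ε ^ (α + 1 + k) = ε ^ (α + 1) * ε ^ k := fun k => by
    rw [Real.rpow_add hε, Real.rpow_natCast]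
  have hterm : ∀ (u v : ℝ) (mn : ℕ × ℕ), u ^ mn.1 * v ^ mn.2 / D mn *
      ((ascPochhammer ℝ (mn.1 + mn.2)).eval (α + 1) * Real.Gamma (α + 1) /
        (2 * c * ε ^ (α + 1 + ((mn.1 + mn.2 : ℕ) : ℝ)))) =
      C * ((u / ε) ^ mn.1 * (v / ε) ^ mn.2 *
        ((ascPochhammer ℝ (mn.1 + mn.2)).eval (α + 1) / D mn)) := by
    intro u v mn
    have := hD mn
    rw [hpow, hC, pow_add, div_pow, div_pow]
    field_simp
  have hF : ∀ mn, ∫ l, F mn l ∂besselMeasure c α =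
      C * ((-(x ^ 2 / 4) / ε) ^ mn.1 * (-(y ^ 2 / 4) / ε) ^ mn.2 *
        ((ascPochhammer ℝ (mn.1 + mn.2)).eval (α + 1) / D mn)) := fun mn => by
    rw [← hterm, ← integral_moment_besselMeasure hc hα hε, integral_const_mul]
  have hFn : ∀ mn, ∫ l, ‖F mn l‖ ∂besselMeasure c α =
      C * (((x ^ 2 / 4) / ε) ^ mn.1 * ((y ^ 2 / 4) / ε) ^ mn.2 *
        ((ascPochhammer ℝ (mn.1 + mn.2)).eval (α + 1) / D mn)) := fun mn => by
    rw [← hterm, ← integral_moment_besselMeasure hc hα hε, ← integral_const_mul]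
    congr 1
    funext l
    have h1 := (even_two_mul (mn.1 + mn.2)).pow_nonneg l
    simp only [F]
    rw [norm_mul, norm_div, norm_mul, norm_pow, norm_pow, norm_neg, norm_neg,
      Real.norm_of_nonneg (hD mn).le, Real.norm_of_nonneg (mul_nonneg (Real.exp_pos _).le h1),
      Real.norm_of_nonneg (by positivity), Real.norm_of_nonneg (by positivity)]
  -- The integrals of the absolute values form the same Weber series with the signs of both
  -- arguments reversed, which converges; this permits termwise integration.
  have hsum := hasSum_integral_of_summable_integral_norm hFint (by
    simp only [hFn]
    exact ((hasSum_weber (α + 1) hβ (x ^ 2 / 4 / ε) (y ^ 2 / 4 / ε)).summable).mul_left C)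
  simp only [hF] at hsum
  have h2 := (hasSum_weber (α + 1) hβ (-(x ^ 2 / 4) / ε) (-(y ^ 2 / 4) / ε)).mul_left C
  have h3 := hsum.unique h2
  have hser : ∀ l, ∑' mn, F mn l = Real.exp (-(ε * l ^ 2)) *
      (normalizedBessel α (x * l) * normalizedBessel α (y * l)) := by
    intro l
    rw [normalizedBessel_eq α hα, normalizedBessel_eq α hα, hypZeroOne, hypZeroOne,
      tsum_mul_tsum_of_summable_norm (summable_hypZeroOne _ hβ _).norm
        (summable_hypZeroOne _ hβ _).norm, ← tsum_mul_left]
    congr 1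
    funext mn
    have h1 := ascPochhammer_pos mn.1 (α + 1) hβ
    have h2 := ascPochhammer_pos mn.2 (α + 1) hβ
    simp only [F, D]
    rw [show -((x * l) ^ 2 / 4) = -(x ^ 2 / 4) * l ^ 2 by ring,
      show -((y * l) ^ 2 / 4) = -(y ^ 2 / 4) * l ^ 2 by ring, mul_pow, mul_pow (-(y ^ 2 / 4)),
      ← pow_mul, ← pow_mul, mul_add 2, pow_add]
    field_simp
  simp only [hser] at h3
  rw [h3]
  congr 2
  · congr 2 <;> (field_simp)
  · congr 1
    field_simp

/-- All terms are nonnegative, so the sum and integral commute; the k-th Gaussian moment cancels the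
Pochhammer symbol and leaves the series of e^a. This gives the mass of the last-variable factor of
the heat kernel. -/
theorem lintegral_exp_mul_hypZeroOne {c α ε : ℝ} (hc : 0 < c) (hα : -1 < α) (hε : 0 < ε)
    (a : ℝ) (ha : 0 ≤ a) :
    ∫⁻ y, ENNReal.ofReal (Real.exp (-(y ^ 2 / (4 * ε))) *
        hypZeroOne (α + 1) (a * (y ^ 2 / (4 * ε)))) ∂besselMeasure c α =
      ENNReal.ofReal (Real.Gamma (α + 1) * (4 * ε) ^ (α + 1) / (2 * c) * Real.exp a) := by
  have hβ : 0 < α + 1 := by linarith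
  have hG := Real.Gamma_pos_of_pos hβ
  have h4 : 0 < (4 * ε)⁻¹ := by positivity
  let D : ℕ → ℝ := fun k => (k.factorial : ℝ) * (ascPochhammer ℝ k).eval (α + 1)
  have hD : ∀ k, 0 < D k := fun k => by
    have h1 := ascPochhammer_pos k (α + 1) hβ
    positivity
  have hser : ∀ y : ℝ, ENNReal.ofReal (Real.exp (-(y ^ 2 / (4 * ε))) *
        hypZeroOne (α + 1) (a * (y ^ 2 / (4 * ε)))) =
      ∑' k : ℕ, ENNReal.ofReal ((a / (4 * ε)) ^ k / D k) *
        ENNReal.ofReal (Real.exp (-((4 * ε)⁻¹ * y ^ 2)) * y ^ (2 * k)) := by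
    intro y
    rw [hypZeroOne, ← tsum_mul_left, ENNReal.ofReal_tsum_of_nonneg]
    · congr 1
      funext k
      have := hD k
      rw [← ENNReal.ofReal_mul (by positivity)]
      congr 1
      rw [pow_mul, show a * (y ^ 2 / (4 * ε)) = (a / (4 * ε)) * y ^ 2 by field_simp, mul_pow,
        show (4 * ε)⁻¹ * y ^ 2 = y ^ 2 / (4 * ε) by field_simp]
      simp only [D]
      ring
    · intro k
      have := hD k
      simp only [D] at this
      positivity
    · exact (summable_hypZeroOne _ hβ _).mul_left _
  simp only [hser]
  rw [lintegral_tsum (fun k => by fun_prop)]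
  have hterm : ∀ k : ℕ, ∫⁻ y, ENNReal.ofReal ((a / (4 * ε)) ^ k / D k) *
        ENNReal.ofReal (Real.exp (-((4 * ε)⁻¹ * y ^ 2)) * y ^ (2 * k)) ∂besselMeasure c α =
      ENNReal.ofReal (Real.Gamma (α + 1) * (4 * ε) ^ (α + 1) / (2 * c) *
        (a ^ k / (k.factorial : ℝ))) := by
    intro k
    have := hD k
    have h1 := ascPochhammer_pos k (α + 1) hβ
    rw [lintegral_const_mul _ (by fun_prop), lintegral_moment_besselMeasure hc hα h4,
      ← ENNReal.ofReal_mul (by positivity), Real.rpow_add h4, Real.rpow_natCast,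
      Real.inv_rpow (by positivity), div_pow, inv_pow]
    congr 1
    simp only [D]
    field_simp
  simp only [hterm]
  have hexp : HasSum (fun k : ℕ => a ^ k / (k.factorial : ℝ)) (Real.exp a) := by
    rw [Real.exp_eq_exp_ℝ]
    exact NormedSpace.expSeries_div_hasSum_exp a
  rw [← ENNReal.ofReal_tsum_of_nonneg (fun k => by positivity) (hexp.summable.mul_left _),
    tsum_mul_left, hexp.tsum_eq]

/-! ### The L² bound: Schur's test and the heat kernel -/

/-- Schur's test for a regularised integral operator: if the kernel of `T^* w T` has mass at most
one in each variable, then `‖T u‖_{L²(w μ)} ≤ ‖u‖_{L²(μ)}` for integrable `u`. -/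
theorem lintegral_enorm_integral_sq_mul_le_of_schur {X : Type*} [MeasurableSpace X] {μ : Measure X}
    [SFinite μ] {K : X → X → ℂ} (hK : Measurable (Function.uncurry K))
    (hK1 : ∀ x l, ‖K x l‖ ≤ 1) {w : X → ℝ} (hw0 : ∀ l, 0 ≤ w l) (hwi : Integrable w μ)
    (hmass : ∀ x, ∫⁻ y, ‖∫ l, K x l * (starRingEnd ℂ) (K y l) * (w l : ℂ) ∂μ‖ₑ ∂μ ≤ 1)
    {u : X → ℂ} (hu : Integrable u μ) :
    ∫⁻ l, ‖∫ x, u x * K x l ∂μ‖ₑ ^ 2 * ENNReal.ofReal (w l) ∂μ ≤ ∫⁻ x, ‖u x‖ₑ ^ 2 ∂μ := by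
  set conj := starRingEnd ℂ
  set G : X → X → ℂ := fun x y => ∫ l, K x l * conj (K y l) * (w l : ℂ) ∂μ with hG
  set U : X → ℂ := fun l => ∫ x, u x * K x l ∂μ with hU
  have hwae : AEStronglyMeasurable (fun l => (w l : ℂ)) μ :=
    Complex.continuous_ofReal.comp_aestronglyMeasurable hwi.1
  have hwC : Integrable (fun l => (w l : ℂ)) μ := hwi.ofReal
  let Φ : X → X × X → ℂ := fun l z => u z.1 * conj (u z.2) * (K z.1 l * conj (K z.2 l) * (w l : ℂ))
  have hconju : Integrable (fun x => conj (u x)) μ := by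
    refine hu.norm.mono' (Complex.continuous_conj.comp_aestronglyMeasurable hu.1) ?_
    exact ae_of_all _ fun x => by simp [conj]
  -- Fubini on the triple product needs only u and w in L¹ and |K| ≤ 1; u need not be square
  -- integrable.
  have hΦi : Integrable (Function.uncurry Φ) (μ.prod (μ.prod μ)) := by
    have h1 : Integrable (fun p : X × X × X => (w p.1 : ℂ) * (u p.2.1 * conj (u p.2.2)))
        (μ.prod (μ.prod μ)) := hwC.mul_prod (hu.mul_prod hconju)
    have h2 : Measurable fun p : X × X × X => K p.2.1 p.1 * conj (K p.2.2 p.1) := by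
      have hc : Measurable conj := Complex.continuous_conj.measurable
      exact (hK.comp (measurable_snd.fst.prodMk measurable_fst)).mul
        (hc.comp (hK.comp (measurable_snd.snd.prodMk measurable_fst)))
    have h3 := h1.mul_bdd (c := 1) h2.aestronglyMeasurable (ae_of_all _ fun p => by
      rw [norm_mul]
      have : ‖conj (K p.2.2 p.1)‖ = ‖K p.2.2 p.1‖ := by simp [conj]
      rw [this]
      exact mul_le_one₀ (hK1 _ _) (norm_nonneg _) (hK1 _ _))
    refine h3.congr (ae_of_all _ fun p => ?_)
    simp only [Function.uncurry, Φ]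
    ring
  have hsq : ∀ l, U l * conj (U l) * (w l : ℂ) = ∫ z, Φ l z ∂(μ.prod μ) := by
    intro l
    have h1 : conj (U l) = ∫ x, conj (u x * K x l) ∂μ := integral_conj.symm
    rw [h1, hU, ← integral_prod_mul, ← integral_mul_const]
    congr 1
    funext z
    simp only [Φ, map_mul]
    ring
  have hreal : ∀ l, U l * conj (U l) * (w l : ℂ) = ((‖U l‖ ^ 2 * w l : ℝ) : ℂ) := by
    intro l
    rw [Complex.mul_conj, Complex.normSq_eq_norm_sq]
    push_cast
    ring
  have hint : Integrable (fun l => ‖U l‖ ^ 2 * w l) μ := by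
    have := hΦi.integral_prod_left.re
    refine this.congr (ae_of_all _ fun l => ?_)
    have h := (hsq l).symm.trans (hreal l)
    simp only [Function.uncurry] at h ⊢
    simp only [h]
    exact Complex.ofReal_re _
  have hLHS : ∫⁻ l, ‖U l‖ₑ ^ 2 * ENNReal.ofReal (w l) ∂μ =
      ‖∫ z, u z.1 * conj (u z.2) * G z.1 z.2 ∂(μ.prod μ)‖ₑ := by
    have e1 : ∫ z, u z.1 * conj (u z.2) * G z.1 z.2 ∂(μ.prod μ) =
        ((∫ l, ‖U l‖ ^ 2 * w l ∂μ : ℝ) : ℂ) := by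
      rw [← integral_complex_ofReal]
      simp_rw [← hreal, hsq]
      rw [integral_integral_swap hΦi]
      congr 1
      funext z
      simp only [Φ, hG]
      rw [integral_const_mul]
    rw [e1, ← ofReal_norm, Complex.norm_real, Real.norm_of_nonneg
      (integral_nonneg fun l => mul_nonneg (sq_nonneg _) (hw0 l)),
      ofReal_integral_eq_lintegral_ofReal hint
        (ae_of_all _ fun l => mul_nonneg (sq_nonneg _) (hw0 l))]
    refine lintegral_congr fun l => ?_
    rw [ENNReal.ofReal_mul (sq_nonneg _), ENNReal.ofReal_pow (norm_nonneg _), ofReal_norm]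
  rw [hLHS]
  have hGsymm : ∀ x y, ‖G x y‖ₑ = ‖G y x‖ₑ := by
    intro x y
    have : G x y = conj (G y x) := by
      simp only [hG]
      rw [← integral_conj]
      congr 1
      funext l
      simp only [conj, map_mul, Complex.conj_conj, Complex.conj_ofReal]
      ring
    rw [this, ← ofReal_norm, ← ofReal_norm]
    simp [conj]
  have hGs : AEStronglyMeasurable (fun z : X × X => G z.1 z.2) (μ.prod μ) := by
    have hm : AEStronglyMeasurable (fun p : (X × X) × X =>
        K p.1.1 p.2 * conj (K p.1.2 p.2) * (w p.2 : ℂ)) ((μ.prod μ).prod μ) := by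
      have hc : Measurable conj := Complex.continuous_conj.measurable
      exact ((hK.comp (measurable_fst.fst.prodMk measurable_snd)).mul
        (hc.comp (hK.comp (measurable_fst.snd.prodMk measurable_snd)))).aestronglyMeasurable.mul
        (hwae.comp_snd (μ := μ.prod μ))
    exact hm.integral_prod_right'
  have hGm : AEMeasurable (fun z : X × X => ‖G z.1 z.2‖ₑ) (μ.prod μ) := hGs.enorm
  have hum : AEMeasurable (fun x => ‖u x‖ₑ ^ 2) μ := hu.1.enorm.pow_const 2
  have hA : ∫⁻ z, ‖u z.1‖ₑ ^ 2 * ‖G z.1 z.2‖ₑ ∂(μ.prod μ) ≤ ∫⁻ x, ‖u x‖ₑ ^ 2 ∂μ := by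
    have hm : AEMeasurable (fun z : X × X => ‖u z.1‖ₑ ^ 2 * ‖G z.1 z.2‖ₑ) (μ.prod μ) :=
      (hum.comp_fst (ν := μ)).mul hGm
    rw [lintegral_prod _ hm]
    refine lintegral_mono_ae ?_
    filter_upwards [hGs.prodMk_left] with x hx
    rw [lintegral_const_mul'' _ hx.enorm]
    exact mul_le_of_le_one_right' (hmass x)
  have hB : ∫⁻ z, ‖u z.2‖ₑ ^ 2 * ‖G z.1 z.2‖ₑ ∂(μ.prod μ) ≤ ∫⁻ x, ‖u x‖ₑ ^ 2 ∂μ := by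
    rw [← lintegral_prod_swap]
    refine le_trans (le_of_eq (lintegral_congr fun z => ?_)) hA
    simp only [Prod.fst_swap, Prod.snd_swap]
    rw [hGsymm]
  -- From 2|u(x)u(y)| ≤ |u(x)|² + |u(y)|², each half is controlled by the mass of |G| in one
  -- variable.
  have h2 : 2 * ‖∫ z, u z.1 * conj (u z.2) * G z.1 z.2 ∂(μ.prod μ)‖ₑ ≤
      2 * ∫⁻ x, ‖u x‖ₑ ^ 2 ∂μ := by
    calc 2 * ‖∫ z, u z.1 * conj (u z.2) * G z.1 z.2 ∂(μ.prod μ)‖ₑ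
        ≤ 2 * ∫⁻ z, ‖u z.1 * conj (u z.2) * G z.1 z.2‖ₑ ∂(μ.prod μ) := by
          gcongr; exact enorm_integral_le_lintegral_enorm _
      _ = ∫⁻ z, 2 * ‖u z.1 * conj (u z.2) * G z.1 z.2‖ₑ ∂(μ.prod μ) :=
          (lintegral_const_mul' _ _ (by norm_num)).symm
      _ ≤ ∫⁻ z, (‖u z.1‖ₑ ^ 2 * ‖G z.1 z.2‖ₑ + ‖u z.2‖ₑ ^ 2 * ‖G z.1 z.2‖ₑ) ∂(μ.prod μ) := by
          refine lintegral_mono fun z => ?_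
          have hc : ‖conj (u z.2)‖ₑ = ‖u z.2‖ₑ := by
            rw [← ofReal_norm, ← ofReal_norm]; simp [conj]
          simp only [enorm_mul, hc]
          rw [← mul_assoc, ← add_mul]
          gcongr
          rw [← ofReal_norm, ← ofReal_norm, ← ENNReal.ofReal_mul (norm_nonneg _),
            ← ENNReal.ofReal_pow (norm_nonneg _), ← ENNReal.ofReal_pow (norm_nonneg _),
            ← ENNReal.ofReal_add (sq_nonneg _) (sq_nonneg _),
            show (2 : ENNReal) = ENNReal.ofReal 2 by simp, ← ENNReal.ofReal_mul (by norm_num)]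
          apply ENNReal.ofReal_le_ofReal
          nlinarith [sq_nonneg (‖u z.1‖ - ‖u z.2‖)]
      _ = _ := lintegral_add_left' ((hum.comp_fst (ν := μ)).mul hGm) _
      _ ≤ _ := by rw [two_mul]; exact add_le_add hA hB
  exact (ENNReal.mul_le_mul_iff_right (by norm_num) (by norm_num)).1 h2

theorem abs_normalizedBessel_le_one {α : ℝ} (hα : -(1 / 2) < α) (x : ℝ) :
    |normalizedBessel α x| ≤ 1 := by
  rw [normalizedBessel_eq α (by linarith)]
  exact abs_hypZeroOne_neg_le_one _ (by linarith) _ (by positivity)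

theorem continuous_normalizedBessel {α : ℝ} (hα : -1 < α) : Continuous (normalizedBessel α) := by
  rw [funext (normalizedBessel_eq α hα)]
  exact (continuous_hypZeroOne (α + 1) (by linarith)).comp (by fun_prop)

theorem continuous_weinsteinKernel (d : ℕ) {α : ℝ} (hα : -1 < α) :
    Continuous (Function.uncurry (weinsteinKernel (d := d) α)) := by
  have h := continuous_normalizedBessel hα
  unfold weinsteinKernel Function.uncurry
  fun_prop

theorem norm_weinsteinKernel_le_one {d : ℕ} {α : ℝ} (hα : -(1 / 2) < α) (x l : WeinsteinSpace d) :
    ‖weinsteinKernel α x l‖ ≤ 1 := by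
  rw [weinsteinKernel, norm_mul, Complex.norm_exp, Complex.norm_real]
  simpa using abs_normalizedBessel_le_one hα (x.2 * l.2)

/-- The Gaussian `exp(-ε |l|²)`. -/
def gaussianWeight {d : ℕ} (ε : ℝ) (l : WeinsteinSpace d) : ℝ :=
  Real.exp (-(ε * ‖l.1‖ ^ 2)) * Real.exp (-(ε * l.2 ^ 2))

theorem integrable_exp_neg_mul_sq_norm (d : ℕ) {ε : ℝ} (hε : 0 < ε) :
    Integrable fun x : EuclideanSpace ℝ (Fin d) => Real.exp (-(ε * ‖x‖ ^ 2)) := by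
  have h := (GaussianFourier.integrable_cexp_neg_mul_sq_norm_add (b := (ε : ℂ)) (by simpa using hε)
    0 (0 : EuclideanSpace ℝ (Fin d))).norm
  refine h.congr (ae_of_all _ fun x => ?_)
  simp only [Complex.norm_exp]
  simp [← Complex.ofReal_pow]

theorem integrable_gaussianWeight (d : ℕ) {α ε : ℝ} (hα : -1 < α) (hε : 0 < ε) :
    Integrable (gaussianWeight (d := d) ε) (weinsteinMeasure d α) := by
  rw [weinsteinMeasure_eq_prod]
  have h := integrable_moment_besselMeasure (weinsteinConst_pos d hα) hα hε 0
  simp only [mul_zero, pow_zero, mul_one] at h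
  exact (integrable_exp_neg_mul_sq_norm d hε).mul_prod h

/-- The integral factors: the Fourier transform of a Gaussian in the first d variables, Weber's
integral in the last. -/
theorem integral_weinsteinKernel_mul_conj_mul_gaussianWeight (d : ℕ) {α ε : ℝ} (hα : -1 < α)
    (hε : 0 < ε) (x y : WeinsteinSpace d) :
    ∫ l, weinsteinKernel α x l * (starRingEnd ℂ) (weinsteinKernel α y l) *
      (gaussianWeight ε l : ℂ) ∂weinsteinMeasure d α =
    (((Real.pi / ε) ^ ((d : ℝ) / 2) * Real.exp (-(‖x.1 - y.1‖ ^ 2 / (4 * ε))) *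
      (Real.Gamma (α + 1) / (2 * weinsteinConst d α * ε ^ (α + 1)) *
      (Real.exp (-(x.2 ^ 2 / (4 * ε))) * Real.exp (-(y.2 ^ 2 / (4 * ε))) *
        hypZeroOne (α + 1) (x.2 ^ 2 / (4 * ε) * (y.2 ^ 2 / (4 * ε))))) : ℝ) : ℂ) := by
  rw [← integral_exp_mul_normalizedBessel_mul (weinsteinConst_pos d hα) hα hε,
    weinsteinMeasure_eq_prod, Complex.ofReal_mul, ← integral_complex_ofReal]
  have h := GaussianFourier.integral_cexp_neg_mul_sq_norm_add (b := (ε : ℂ)) (by simpa using hε)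
    (-Complex.I) (x.1 - y.1)
  have e : (((Real.pi / ε) ^ ((d : ℝ) / 2) * Real.exp (-(‖x.1 - y.1‖ ^ 2 / (4 * ε))) : ℝ) : ℂ) =
      ∫ v : EuclideanSpace ℝ (Fin d), Complex.exp (-(ε : ℂ) * ‖v‖ ^ 2 +
        -Complex.I * (inner ℝ (x.1 - y.1) v : ℝ)) := by
    rw [h, Complex.ofReal_mul, Complex.ofReal_cpow (by positivity), Complex.ofReal_exp]
    rw [finrank_euclideanSpace_fin, neg_sq, Complex.I_sq]
    push_cast
    ring_nf
  rw [e, ← integral_prod_mul]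
  congr 1
  funext l
  rw [weinsteinKernel, weinsteinKernel, gaussianWeight, map_mul, ← Complex.exp_conj,
    Complex.conj_ofReal]
  have e2 : Complex.exp (-(ε : ℂ) * ‖l.1‖ ^ 2 + -Complex.I * (inner ℝ (x.1 - y.1) l.1 : ℝ)) =
      Complex.exp (-Complex.I * ((inner ℝ x.1 l.1 : ℝ) : ℂ)) *
      Complex.exp ((starRingEnd ℂ) (-Complex.I * ((inner ℝ y.1 l.1 : ℝ) : ℂ))) *
      Complex.exp (-(ε * ‖l.1‖ ^ 2)) := by
    rw [← Complex.exp_add, ← Complex.exp_add]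
    congr 1
    simp only [map_mul, map_neg, Complex.conj_I, Complex.conj_ofReal, inner_sub_left]
    push_cast
    ring
  rw [e2]
  push_cast
  ring

/-- The explicit kernel is nonnegative, so its absolute value can be dropped. The integral over the
last variable produces exp(x_{d+1}²/(4ε)), which cancels the Gaussian factor in x, and the
normalisation of the measure makes the remaining constant 1. -/
theorem lintegral_enorm_heatKernel (d : ℕ) {α ε : ℝ} (hα : -1 < α) (hε : 0 < ε)
    (x : WeinsteinSpace d) :
    ∫⁻ y, ‖∫ l, weinsteinKernel α x l * (starRingEnd ℂ) (weinsteinKernel α y l) *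
      (gaussianWeight ε l : ℂ) ∂weinsteinMeasure d α‖ₑ ∂weinsteinMeasure d α = 1 := by
  have hβ : 0 < α + 1 := by linarith
  have hG := Real.Gamma_pos_of_pos hβ
  have hc := weinsteinConst_pos d hα
  have hh := continuous_hypZeroOne (α + 1) hβ
  have hnn : ∀ z : ℝ, 0 ≤ z → 0 ≤ hypZeroOne (α + 1) z := fun z hz => by
    refine tsum_nonneg fun k => ?_
    have := ascPochhammer_pos k (α + 1) hβ
    positivity
  simp only [integral_weinsteinKernel_mul_conj_mul_gaussianWeight d hα hε]
  set A : ℝ := (Real.pi / ε) ^ ((d : ℝ) / 2) * (Real.Gamma (α + 1) /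
    (2 * weinsteinConst d α * ε ^ (α + 1)) * Real.exp (-(x.2 ^ 2 / (4 * ε)))) with hA
  have hpt : ∀ y : WeinsteinSpace d,
      ‖(((Real.pi / ε) ^ ((d : ℝ) / 2) * Real.exp (-(‖x.1 - y.1‖ ^ 2 / (4 * ε))) *
      (Real.Gamma (α + 1) / (2 * weinsteinConst d α * ε ^ (α + 1)) *
      (Real.exp (-(x.2 ^ 2 / (4 * ε))) * Real.exp (-(y.2 ^ 2 / (4 * ε))) *
        hypZeroOne (α + 1) (x.2 ^ 2 / (4 * ε) * (y.2 ^ 2 / (4 * ε))))) : ℝ) : ℂ)‖ₑ =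
      ENNReal.ofReal A * (ENNReal.ofReal (Real.exp (-(‖x.1 - y.1‖ ^ 2 / (4 * ε)))) *
        ENNReal.ofReal (Real.exp (-(y.2 ^ 2 / (4 * ε))) *
          hypZeroOne (α + 1) (x.2 ^ 2 / (4 * ε) * (y.2 ^ 2 / (4 * ε))))) := by
    intro y
    have h0 := hnn (x.2 ^ 2 / (4 * ε) * (y.2 ^ 2 / (4 * ε))) (by positivity)
    rw [← ofReal_norm, Complex.norm_real, Real.norm_of_nonneg (by positivity),
      ← ENNReal.ofReal_mul (by positivity), ← ENNReal.ofReal_mul (by positivity)]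
    congr 1
    rw [hA]
    ring
  simp only [hpt]
  rw [lintegral_const_mul' _ _ ENNReal.ofReal_ne_top, weinsteinMeasure_eq_prod,
    lintegral_prod_mul (f := fun y' : EuclideanSpace ℝ (Fin d) =>
      ENNReal.ofReal (Real.exp (-(‖x.1 - y'‖ ^ 2 / (4 * ε)))))
      (g := fun s : ℝ => ENNReal.ofReal (Real.exp (-(s ^ 2 / (4 * ε))) *
          hypZeroOne (α + 1) (x.2 ^ 2 / (4 * ε) * (s ^ 2 / (4 * ε)))))
      (by fun_prop) (by fun_prop),
    lintegral_exp_mul_hypZeroOne hc hα hε _ (by positivity),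
    lintegral_sub_left_eq_self
      (fun z : EuclideanSpace ℝ (Fin d) => ENNReal.ofReal (Real.exp (-(‖z‖ ^ 2 / (4 * ε)))))]
  have h4 : 0 < (4 * ε)⁻¹ := by positivity
  have hgauss : ∫⁻ z : EuclideanSpace ℝ (Fin d),
      ENNReal.ofReal (Real.exp (-(‖z‖ ^ 2 / (4 * ε)))) =
      ENNReal.ofReal ((4 * Real.pi * ε) ^ ((d : ℝ) / 2)) := by
    have e : ∀ z : EuclideanSpace ℝ (Fin d), -(‖z‖ ^ 2 / (4 * ε)) = -((4 * ε)⁻¹ * ‖z‖ ^ 2) :=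
      fun z => by rw [inv_mul_eq_div]
    simp only [e]
    rw [← ofReal_integral_eq_lintegral_ofReal (integrable_exp_neg_mul_sq_norm d h4)
      (ae_of_all _ fun z => (Real.exp_pos _).le)]
    have h := GaussianFourier.integral_rexp_neg_mul_sq_norm (V := EuclideanSpace ℝ (Fin d)) h4
    simp only [neg_mul] at h
    rw [h, finrank_euclideanSpace_fin, div_inv_eq_mul,
      show Real.pi * (4 * ε) = 4 * Real.pi * ε by ring]
  rw [hgauss, ← ENNReal.ofReal_mul (by positivity), ← ENNReal.ofReal_mul (by positivity)]
  have p0 : 0 < Real.pi / ε := by positivity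
  have e1 : (4 * Real.pi * ε) ^ ((d : ℝ) / 2) * (Real.pi / ε) ^ ((d : ℝ) / 2) =
      (2 * Real.pi) ^ ((d : ℝ) / 2) * (2 * Real.pi) ^ ((d : ℝ) / 2) := by
    rw [← Real.mul_rpow (by positivity) p0.le, ← Real.mul_rpow (by positivity) (by positivity)]
    congr 1
    field_simp
    ring
  have e2 : (4 * ε) ^ (α + 1) = 4 * (2 ^ α * 2 ^ α) * ε ^ (α + 1) := by
    rw [Real.mul_rpow (by norm_num) hε.le, show (4 : ℝ) = 2 * 2 by norm_num,
      Real.mul_rpow (by norm_num) (by norm_num), Real.rpow_add (by norm_num), Real.rpow_one]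
    ring
  have p1 : 0 < (2 * Real.pi) ^ ((d : ℝ) / 2) := by positivity
  have p3 : (0 : ℝ) < 2 ^ α := by positivity
  have p4 : 0 < ε ^ (α + 1) := by positivity
  have p5 := Real.exp_pos (x.2 ^ 2 / (4 * ε))
  rw [ENNReal.ofReal_eq_one, hA, weinsteinConst, Real.exp_neg, e2]
  -- With the powers turned into atoms, the only relation still needed among them is `e1`, that is Q
  -- R = P².
  generalize (2 * Real.pi) ^ ((d : ℝ) / 2) = P at *
  generalize (4 * Real.pi * ε) ^ ((d : ℝ) / 2) = Q at *
  generalize (Real.pi / ε) ^ ((d : ℝ) / 2) = R at *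
  generalize (2 : ℝ) ^ α = S at *
  generalize ε ^ (α + 1) = E at *
  generalize Real.exp (x.2 ^ 2 / (4 * ε)) = W at *
  field_simp
  linear_combination 4 * e1

theorem aestronglyMeasurable_weinsteinIntegral {d : ℕ} {α : ℝ} (hα : -1 < α)
    {u : WeinsteinSpace d → ℂ} (hu : AEStronglyMeasurable u (weinsteinMeasure d α))
    (μ : Measure (WeinsteinSpace d)) [SFinite μ] :
    AEStronglyMeasurable (weinsteinIntegral α u) μ := by
  have hK := continuous_weinsteinKernel d hα
  have h : AEStronglyMeasurable (fun p : WeinsteinSpace d × WeinsteinSpace d =>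
      u p.2 * weinsteinKernel α p.2 p.1) (μ.prod (weinsteinMeasure d α)) :=
    (hu.comp_snd (μ := μ)).mul (hK.comp continuous_swap).aestronglyMeasurable
  exact h.integral_prod_right'

theorem integrable_mul_weinsteinKernel {d : ℕ} {α : ℝ} (hα : -(1 / 2) < α)
    {u : WeinsteinSpace d → ℂ} (hu : Integrable u (weinsteinMeasure d α)) (l : WeinsteinSpace d) :
    Integrable (fun x => u x * weinsteinKernel α x l) (weinsteinMeasure d α) :=
  hu.mul_bdd (c := 1) ((continuous_weinsteinKernel d (by linarith)).comp
    (continuous_id.prodMk continuous_const)).aestronglyMeasurable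
    (ae_of_all _ fun x => norm_weinsteinKernel_le_one hα x l)

theorem enorm_weinsteinIntegral_le {d : ℕ} {α : ℝ} (hα : -(1 / 2) < α)
    (u : WeinsteinSpace d → ℂ) (l : WeinsteinSpace d) :
    ‖weinsteinIntegral α u l‖ₑ ≤ ∫⁻ x, ‖u x‖ₑ ∂weinsteinMeasure d α := by
  refine (enorm_integral_le_lintegral_enorm _).trans (lintegral_mono fun x => ?_)
  rw [enorm_mul]
  refine mul_le_of_le_one_right' ?_
  rw [← ofReal_norm, ENNReal.ofReal_le_one]
  exact norm_weinsteinKernel_le_one hα x l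

/-- Bessel's inequality for the Weinstein transform of integrable functions. -/
theorem lintegral_enorm_weinsteinIntegral_sq_le {d : ℕ} {α : ℝ} (hα : -(1 / 2) < α)
    {u : WeinsteinSpace d → ℂ} (hu : Integrable u (weinsteinMeasure d α)) :
    ∫⁻ l, ‖weinsteinIntegral α u l‖ₑ ^ 2 ∂weinsteinMeasure d α ≤
      ∫⁻ x, ‖u x‖ₑ ^ 2 ∂weinsteinMeasure d α := by
  have hα1 : -1 < α := by linarith
  set μ := weinsteinMeasure d α
  let ε : ℕ → ℝ := fun n => 1 / ((n : ℝ) + 1)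
  have hε : ∀ n, 0 < ε n := fun n => by positivity
  have hmeas : AEMeasurable (fun l => ‖weinsteinIntegral α u l‖ₑ ^ 2) μ :=
    (aestronglyMeasurable_weinsteinIntegral hα1 hu.1 μ).enorm.pow_const 2
  have hb : ∀ n, ∫⁻ l, ‖weinsteinIntegral α u l‖ₑ ^ 2 * ENNReal.ofReal (gaussianWeight (ε n) l) ∂μ
      ≤ ∫⁻ x, ‖u x‖ₑ ^ 2 ∂μ := fun n =>
    lintegral_enorm_integral_sq_mul_le_of_schur (continuous_weinsteinKernel d hα1).measurable
      (norm_weinsteinKernel_le_one hα)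
      (fun l => mul_nonneg (Real.exp_pos _).le (Real.exp_pos _).le)
      (integrable_gaussianWeight d hα1 (hε n))
      (fun x => (lintegral_enorm_heatKernel d hα1 (hε n) x).le) hu
  have hlim : ∀ l : WeinsteinSpace d, Tendsto (fun n => ‖weinsteinIntegral α u l‖ₑ ^ 2 *
      ENNReal.ofReal (gaussianWeight (ε n) l)) atTop (𝓝 (‖weinsteinIntegral α u l‖ₑ ^ 2)) := by
    intro l
    have h0 : Tendsto ε atTop (𝓝 0) := tendsto_one_div_add_atTop_nhds_zero_nat
    have hc : Continuous fun e : ℝ => gaussianWeight e l := by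
      unfold gaussianWeight; fun_prop
    have h1 : Tendsto (fun n => gaussianWeight (ε n) l) atTop (𝓝 1) := by
      have := (hc.tendsto 0).comp h0
      simpa [gaussianWeight, Function.comp_def] using this
    have h2 := ENNReal.tendsto_ofReal h1
    have h3 := ENNReal.Tendsto.const_mul (a := ‖weinsteinIntegral α u l‖ₑ ^ 2) h2 (by simp)
    simpa using h3
  -- Fatou's lemma as ε → 0: the weights tend to 1 pointwise while the bound is independent of ε.
  calc ∫⁻ l, ‖weinsteinIntegral α u l‖ₑ ^ 2 ∂μ
      = ∫⁻ l, liminf (fun n => ‖weinsteinIntegral α u l‖ₑ ^ 2 *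
          ENNReal.ofReal (gaussianWeight (ε n) l)) atTop ∂μ :=
        lintegral_congr fun l => (hlim l).liminf_eq.symm
    _ ≤ liminf (fun n => ∫⁻ l, ‖weinsteinIntegral α u l‖ₑ ^ 2 *
          ENNReal.ofReal (gaussianWeight (ε n) l) ∂μ) atTop := by
        refine lintegral_liminf_le' fun n => hmeas.mul ?_
        have : Continuous (gaussianWeight (d := d) (ε n)) := by unfold gaussianWeight; fun_prop
        fun_prop
    _ ≤ _ := liminf_le_of_le (by isBoundedDefault) fun b hb' => by
        obtain ⟨n, hn⟩ := hb'.exists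
        exact hn.trans (hb n)

/-! ### Interpolation and Hausdorff–Young -/

theorem lintegral_indicator_rpow_mul_le {r a M : ℝ} (hr : -1 < r) (ha : 0 < a) (hM : 0 < M) :
    ∫⁻ t in Set.Ioi (0 : ℝ), {t : ℝ | t * a ≤ M}.indicator (fun t => ENNReal.ofReal (t ^ r)) t =
      ENNReal.ofReal ((M / a) ^ (r + 1) / (r + 1)) := by
  have hset : {t : ℝ | t * a ≤ M} = Set.Iic (M / a) := by
    ext t; simp [le_div_iff₀ ha]
  have hpos : 0 < M / a := by positivity
  rw [hset, lintegral_indicator measurableSet_Iic, Measure.restrict_restrict measurableSet_Iic,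
    Set.inter_comm, Set.Ioi_inter_Iic]
  have hint := intervalIntegral.intervalIntegrable_rpow' (a := 0) (b := M / a) hr
  rw [intervalIntegrable_iff_integrableOn_Ioc_of_le hpos.le] at hint
  rw [← ofReal_integral_eq_lintegral_ofReal hint, ← intervalIntegral.integral_of_le hpos.le,
    integral_rpow (Or.inl hr), Real.zero_rpow (by linarith), sub_zero]
  filter_upwards [ae_restrict_mem measurableSet_Ioc] with t ht
  exact Real.rpow_nonneg ht.1.le _

/-- Interpolation between the types `(1, ∞)` and `(2, 2)`, by Marcinkiewicz' method. -/
theorem lintegral_rpow_le_of_type_one_top_of_type_two_two {X Y : Type*} [MeasurableSpace X]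
    [MeasurableSpace Y] {μ : Measure X} [SFinite μ] {ν : Measure Y} {T : (X → ℂ) → Y → ℂ}
    (hT : ∀ u, Integrable u μ → AEStronglyMeasurable (T u) ν)
    (hadd : ∀ u v, Integrable u μ → Integrable v μ → ∀ y, T (u + v) y = T u y + T v y)
    (h1 : ∀ u, Integrable u μ → ∀ y, ‖T u y‖ₑ ≤ ∫⁻ x, ‖u x‖ₑ ∂μ)
    (h2 : ∀ u, Integrable u μ → ∫⁻ y, ‖T u y‖ₑ ^ 2 ∂ν ≤ ∫⁻ x, ‖u x‖ₑ ^ 2 ∂μ)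
    {p q : ℝ} (hp : 1 < p) (hpq : q * (p - 1) = p) (hq : 2 < q)
    {u : X → ℂ} (hum : Measurable u) (hu : Integrable u μ) {N : ℝ} (hN : 0 < N)
    (huN : ∫⁻ x, ENNReal.ofReal (‖u x‖ ^ p) ∂μ = ENNReal.ofReal N) :
    ∫⁻ y, ENNReal.ofReal (‖T u y‖ ^ q) ∂ν ≤
      ENNReal.ofReal (4 * q * 2 ^ (q - 2) / (q - 2) * N ^ (q - 1)) := by
  have hq2 : 0 < q - 2 := by linarith
  have hp1 : 0 < p - 1 := by linarith
  -- The cut-off is tuned to the level t: off S t one has |u| ≤ t|u|^p/(2N), so the large part has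
  -- L¹ norm, and hence transform, at most t/2. Wherever |Tu| > t, the transform of the small part
  -- then exceeds t/2, and Chebyshev with the L² bound applies.
  let S : ℝ → Set X := fun t => {x | t * ‖u x‖ ^ (p - 1) ≤ 2 * N}
  have hS : ∀ t, MeasurableSet (S t) := fun t => measurableSet_le (by fun_prop) measurable_const
  have hdist : ∀ t ∈ Set.Ioi (0 : ℝ), ν {y | t < ‖T u y‖} * ENNReal.ofReal (t ^ (q - 1)) ≤
      ∫⁻ x, 4 * (ENNReal.ofReal (‖u x‖ ^ 2) *
        (S t).indicator (fun _ => ENNReal.ofReal (t ^ (q - 3))) x) ∂μ := by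
    intro t ht
    have ht : 0 < t := ht
    have ht2 : ENNReal.ofReal (t / 2) ≠ 0 := by simpa using ht
    have hsmall : Integrable ((S t).indicator u) μ := hu.indicator (hS t)
    have hbig : Integrable ((S t)ᶜ.indicator u) μ := hu.indicator (hS t).compl
    have hb : ∫⁻ x, ‖(S t)ᶜ.indicator u x‖ₑ ∂μ ≤ ENNReal.ofReal (t / 2) := by
      calc ∫⁻ x, ‖(S t)ᶜ.indicator u x‖ₑ ∂μ
          ≤ ∫⁻ x, ENNReal.ofReal (t / (2 * N)) * ENNReal.ofReal (‖u x‖ ^ p) ∂μ := by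
            refine lintegral_mono fun x => ?_
            by_cases hx : x ∈ (S t)ᶜ
            · rw [Set.indicator_of_mem hx, ← ofReal_norm, ← ENNReal.ofReal_mul (by positivity)]
              apply ENNReal.ofReal_le_ofReal
              have hx' : 2 * N < t * ‖u x‖ ^ (p - 1) := by simpa [S] using hx
              have hpp : ‖u x‖ ^ p = ‖u x‖ * ‖u x‖ ^ (p - 1) := by
                rw [← Real.rpow_one_add' (norm_nonneg _) (by linarith)]
                congr 1; ring
              rw [hpp]
              have : 1 ≤ t / (2 * N) * ‖u x‖ ^ (p - 1) := by
                rw [div_mul_eq_mul_div, le_div_iff₀ (by positivity)]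
                linarith
              nlinarith [norm_nonneg (u x)]
            · rw [Set.indicator_of_notMem hx]
              simp
        _ = ENNReal.ofReal (t / 2) := by
            rw [lintegral_const_mul' _ _ ENNReal.ofReal_ne_top, huN,
              ← ENNReal.ofReal_mul (by positivity)]
            congr 1
            field_simp
    have hsub : {y | t < ‖T u y‖} ⊆
        {y | ENNReal.ofReal (t / 2) ^ 2 ≤ ‖T ((S t).indicator u) y‖ₑ ^ 2} := by
      intro y hy
      have hy : t < ‖T u y‖ := hy
      have e : T u y = T ((S t).indicator u) y + T ((S t)ᶜ.indicator u) y := by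
        rw [← hadd _ _ hsmall hbig, Set.indicator_self_add_compl]
      have hb' : ‖T ((S t)ᶜ.indicator u) y‖ ≤ t / 2 := by
        have := (h1 _ hbig y).trans hb
        rwa [← ofReal_norm, ENNReal.ofReal_le_ofReal_iff (by positivity)] at this
      have h3 : t / 2 ≤ ‖T ((S t).indicator u) y‖ := by
        rw [e] at hy
        linarith [norm_add_le (T ((S t).indicator u) y) (T ((S t)ᶜ.indicator u) y)]
      change ENNReal.ofReal (t / 2) ^ 2 ≤ ‖T ((S t).indicator u) y‖ₑ ^ 2
      rw [← ofReal_norm]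
      gcongr
    have hcheb : ENNReal.ofReal (t / 2) ^ 2 * ν {y | t < ‖T u y‖} ≤
        ∫⁻ x, ‖(S t).indicator u x‖ₑ ^ 2 ∂μ := by
      calc _ ≤ ENNReal.ofReal (t / 2) ^ 2 *
            ν {y | ENNReal.ofReal (t / 2) ^ 2 ≤ ‖T ((S t).indicator u) y‖ₑ ^ 2} := by
            gcongr
        _ ≤ ∫⁻ y, ‖T ((S t).indicator u) y‖ₑ ^ 2 ∂ν :=
            mul_meas_ge_le_lintegral₀ ((hT _ hsmall).enorm.pow_const 2) _
        _ ≤ _ := h2 _ hsmall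
    have e1 : ENNReal.ofReal (t ^ (q - 1)) =
        ENNReal.ofReal (t / 2) ^ 2 * (4 * ENNReal.ofReal (t ^ (q - 3))) := by
      rw [← ENNReal.ofReal_pow (by positivity), show (4 : ENNReal) = ENNReal.ofReal 4 by simp,
        ← ENNReal.ofReal_mul (by norm_num), ← ENNReal.ofReal_mul (by positivity)]
      congr 1
      rw [show q - 1 = 2 + (q - 3) by ring, Real.rpow_add ht, Real.rpow_two]
      ring
    calc ν {y | t < ‖T u y‖} * ENNReal.ofReal (t ^ (q - 1))
        = 4 * ENNReal.ofReal (t ^ (q - 3)) *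
            (ENNReal.ofReal (t / 2) ^ 2 * ν {y | t < ‖T u y‖}) := by rw [e1]; ring
      _ ≤ 4 * ENNReal.ofReal (t ^ (q - 3)) * ∫⁻ x, ‖(S t).indicator u x‖ₑ ^ 2 ∂μ := by gcongr
      _ = ∫⁻ x, 4 * ENNReal.ofReal (t ^ (q - 3)) * ‖(S t).indicator u x‖ₑ ^ 2 ∂μ :=
          (lintegral_const_mul' _ _ (ENNReal.mul_ne_top (by simp) ENNReal.ofReal_ne_top)).symm
      _ = _ := by
          refine lintegral_congr fun x => ?_
          by_cases hx : x ∈ S t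
          · rw [Set.indicator_of_mem hx, Set.indicator_of_mem hx, ← ofReal_norm,
              ENNReal.ofReal_pow (norm_nonneg _)]
            ring
          · rw [Set.indicator_of_notMem hx, Set.indicator_of_notMem hx]
            simp
  rw [lintegral_rpow_eq_lintegral_meas_lt_mul ν (ae_of_all _ fun y => norm_nonneg _)
    (hT u hu).norm.aemeasurable (by linarith)]
  have hjoint : Measurable (fun z : ℝ × X => 4 * (ENNReal.ofReal (‖u z.2‖ ^ 2) *
      (S z.1).indicator (fun _ => ENNReal.ofReal (z.1 ^ (q - 3))) z.2)) := by
    have hm : MeasurableSet {z : ℝ × X | z.1 * ‖u z.2‖ ^ (p - 1) ≤ 2 * N} :=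
      measurableSet_le (by fun_prop) measurable_const
    have h3 : Measurable fun z : ℝ × X => (S z.1).indicator
        (fun _ => ENNReal.ofReal (z.1 ^ (q - 3))) z.2 := by
      exact (show Measurable fun z : ℝ × X => ENNReal.ofReal (z.1 ^ (q - 3)) by
        fun_prop).indicator hm
    fun_prop
  calc ENNReal.ofReal q * ∫⁻ t in Set.Ioi 0, ν {y | t < ‖T u y‖} * ENNReal.ofReal (t ^ (q - 1))
      ≤ ENNReal.ofReal q * ∫⁻ t in Set.Ioi 0, ∫⁻ x, 4 * (ENNReal.ofReal (‖u x‖ ^ 2) *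
        (S t).indicator (fun _ => ENNReal.ofReal (t ^ (q - 3))) x) ∂μ := by
        refine mul_le_mul_right ?_ _
        exact setLIntegral_mono' measurableSet_Ioi hdist
    _ = ENNReal.ofReal q * ∫⁻ x, (∫⁻ t in Set.Ioi 0, 4 * (ENNReal.ofReal (‖u x‖ ^ 2) *
        (S t).indicator (fun _ => ENNReal.ofReal (t ^ (q - 3))) x)) ∂μ := by
        rw [lintegral_lintegral_swap hjoint.aemeasurable]
    _ = ENNReal.ofReal q * ∫⁻ x, ENNReal.ofReal (4 * ((2 * N) ^ (q - 2) / (q - 2))) *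
          ENNReal.ofReal (‖u x‖ ^ p) ∂μ := by
        congr 1
        refine lintegral_congr fun x => ?_
        -- For u(x) ≠ 0 the t-integral, convergent at 0 because q > 2, gives a multiple of
        -- |u|^(2-(p-1)(q-2)), which is |u|^p because q(p-1) = p.
        rcases (norm_nonneg (u x)).eq_or_lt with h0 | h0
        · simp [← h0, Real.zero_rpow (show p ≠ 0 by linarith)]
        · have ha : 0 < ‖u x‖ ^ (p - 1) := by positivity
          have e : ∀ t : ℝ, (S t).indicator (fun _ => ENNReal.ofReal (t ^ (q - 3))) x =
              {t : ℝ | t * ‖u x‖ ^ (p - 1) ≤ 2 * N}.indicator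
                (fun t => ENNReal.ofReal (t ^ (q - 3))) t := fun t => by
            rfl
          simp only [e]
          rw [lintegral_const_mul' _ _ (by simp), lintegral_const_mul' _ _ ENNReal.ofReal_ne_top,
            lintegral_indicator_rpow_mul_le (by linarith) ha (by positivity),
            show (4 : ENNReal) = ENNReal.ofReal 4 by simp, ← ENNReal.ofReal_mul (by positivity),
            ← ENNReal.ofReal_mul (by norm_num), ← ENNReal.ofReal_mul (by positivity)]
          congr 1
          rw [show q - 3 + 1 = q - 2 by ring, Real.div_rpow (by positivity) ha.le,
            ← Real.rpow_mul h0.le,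
            show ‖u x‖ ^ p = ‖u x‖ ^ 2 / ‖u x‖ ^ ((p - 1) * (q - 2)) by
              rw [← Real.rpow_two, ← Real.rpow_sub h0]
              congr 1
              linarith]
          ring
    _ = _ := by
        rw [lintegral_const_mul' _ _ ENNReal.ofReal_ne_top, huN,
          ← ENNReal.ofReal_mul (by positivity), ← ENNReal.ofReal_mul (by linarith)]
        congr 1
        rw [Real.mul_rpow (by norm_num) hN.le, show q - 1 = (q - 2) + 1 by ring,
          Real.rpow_add hN, Real.rpow_one]
        ring

theorem weinsteinIntegral_congr_ae {d : ℕ} {α : ℝ} {u v : WeinsteinSpace d → ℂ}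
    (h : u =ᵐ[weinsteinMeasure d α] v) : weinsteinIntegral α u = weinsteinIntegral α v := by
  funext l
  refine integral_congr_ae ?_
  filter_upwards [h] with x hx
  rw [hx]

theorem weinsteinIntegral_add {d : ℕ} {α : ℝ} (hα : -(1 / 2) < α) {u v : WeinsteinSpace d → ℂ}
    (hu : Integrable u (weinsteinMeasure d α)) (hv : Integrable v (weinsteinMeasure d α))
    (l : WeinsteinSpace d) :
    weinsteinIntegral α (u + v) l = weinsteinIntegral α u l + weinsteinIntegral α v l := by
  rw [weinsteinIntegral, weinsteinIntegral, weinsteinIntegral,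
    ← integral_add (integrable_mul_weinsteinKernel hα hu l)
      (integrable_mul_weinsteinKernel hα hv l)]
  simp [add_mul]

theorem weinsteinIntegral_sub {d : ℕ} {α : ℝ} (hα : -(1 / 2) < α) {u v : WeinsteinSpace d → ℂ}
    (hu : Integrable u (weinsteinMeasure d α)) (hv : Integrable v (weinsteinMeasure d α))
    (l : WeinsteinSpace d) :
    weinsteinIntegral α (u - v) l = weinsteinIntegral α u l - weinsteinIntegral α v l := by
  rw [weinsteinIntegral, weinsteinIntegral, weinsteinIntegral,
    ← integral_sub (integrable_mul_weinsteinKernel hα hu l)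
      (integrable_mul_weinsteinKernel hα hv l)]
  simp [sub_mul]

theorem eLpNorm_ofReal_eq {X : Type*} [MeasurableSpace X] {μ : Measure X} {r : ℝ} (hr : 0 < r)
    (f : X → ℂ) :
    eLpNorm f (ENNReal.ofReal r) μ = (∫⁻ x, ENNReal.ofReal (‖f x‖ ^ r) ∂μ) ^ (1 / r) := by
  rw [eLpNorm_eq_lintegral_rpow_enorm_toReal (by simpa using hr) ENNReal.ofReal_ne_top,
    ENNReal.toReal_ofReal hr.le]
  congr 1
  refine lintegral_congr fun x => ?_
  rw [← ofReal_norm, ENNReal.ofReal_rpow_of_nonneg (norm_nonneg _) hr.le]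

/-- A Hausdorff–Young inequality for the Weinstein transform. -/
theorem exists_eLpNorm_weinsteinIntegral_le (d : ℕ) {α p q : ℝ} (hα : -(1 / 2) < α)
    (hp : 1 < p) (hp2 : p ≤ 2) (hq : q = p / (p - 1)) :
    ∃ C : ℝ, 0 < C ∧ ∀ u : WeinsteinSpace d → ℂ, MemLp u 1 (weinsteinMeasure d α) →
      MemLp u (ENNReal.ofReal p) (weinsteinMeasure d α) →
      eLpNorm (weinsteinIntegral α u) (ENNReal.ofReal q) (weinsteinMeasure d α) ≤
        ENNReal.ofReal C * eLpNorm u (ENNReal.ofReal p) (weinsteinMeasure d α) := by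
  set μ := weinsteinMeasure d α
  have hp1 : 0 < p - 1 := by linarith
  have hpq : q * (p - 1) = p := by rw [hq]; field_simp
  -- The interpolation constant blows up as q → 2, so p = 2 is taken directly from Bessel's
  -- inequality.
  rcases hp2.eq_or_lt with rfl | hp2
  · have hq2 : q = 2 := by rw [hq]; norm_num
    refine ⟨1, one_pos, fun u hu _ => ?_⟩
    rw [hq2, eLpNorm_ofReal_eq two_pos, eLpNorm_ofReal_eq two_pos, ENNReal.ofReal_one, one_mul]
    have e : ∀ z : ℂ, ENNReal.ofReal (‖z‖ ^ (2 : ℝ)) = ‖z‖ₑ ^ 2 := fun z => by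
      rw [Real.rpow_two, ENNReal.ofReal_pow (norm_nonneg _), ofReal_norm]
    simp only [e]
    refine ENNReal.rpow_le_rpow ?_ (by norm_num)
    exact lintegral_enorm_weinsteinIntegral_sq_le hα (memLp_one_iff_integrable.1 hu)
  · have hq2 : 2 < q := by
      rw [hq, lt_div_iff₀ hp1]; linarith
    set C : ℝ := 4 * q * 2 ^ (q - 2) / (q - 2) with hC
    have hCpos : 0 < C := by
      have : 0 < q - 2 := by linarith
      positivity
    refine ⟨C ^ (1 / q), by positivity, fun u hu hup => ?_⟩
    rw [memLp_one_iff_integrable] at hu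
    -- The interpolation truncates on level sets, so a measurable representative is used.
    set v : WeinsteinSpace d → ℂ := hu.1.mk u with hv
    have huv : u =ᵐ[μ] v := hu.1.ae_eq_mk
    have hvi : Integrable v μ := hu.congr huv
    rw [weinsteinIntegral_congr_ae huv, eLpNorm_congr_ae huv]
    rcases eq_or_ne (eLpNorm v (ENNReal.ofReal p) μ) 0 with h0 | h0
    · rw [eLpNorm_eq_zero_iff hvi.1 (by simp; linarith)] at h0
      have hz : weinsteinIntegral α v = 0 := by
        rw [weinsteinIntegral_congr_ae h0]
        funext l
        simp [weinsteinIntegral]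
      rw [hz]
      simp
    have hvp : eLpNorm v (ENNReal.ofReal p) μ ≠ ⊤ := by
      rw [← eLpNorm_congr_ae huv]; exact hup.2.ne
    rw [eLpNorm_ofReal_eq (by linarith)] at h0 hvp ⊢
    rw [eLpNorm_ofReal_eq (by linarith)]
    set M := ∫⁻ x, ENNReal.ofReal (‖v x‖ ^ p) ∂μ
    have hM0 : M ≠ 0 := fun h => h0 (by rw [h, ENNReal.zero_rpow_of_pos (by positivity)])
    have hMt : M ≠ ⊤ := fun h => hvp (by rw [h, ENNReal.top_rpow_of_pos (by positivity)])
    have hN : 0 < M.toReal := ENNReal.toReal_pos hM0 hMt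
    have h := lintegral_rpow_le_of_type_one_top_of_type_two_two (μ := μ) (ν := μ)
      (T := weinsteinIntegral α)
      (fun u hu => aestronglyMeasurable_weinsteinIntegral (by linarith) hu.1 μ)
      (fun u v hu hv y => weinsteinIntegral_add hα hu hv y)
      (fun u _ y => enorm_weinsteinIntegral_le hα u y)
      (fun u hu => lintegral_enorm_weinsteinIntegral_sq_le hα hu) hp hpq hq2
      hu.1.stronglyMeasurable_mk.measurable hvi hN (ENNReal.ofReal_toReal hMt).symm
    have hqp : (q - 1) * (1 / q) = 1 / p := by
      have : q ≠ 0 := by linarith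
      have : p ≠ 0 := by linarith
      field_simp
      linarith
    calc _ ≤ (ENNReal.ofReal (C * M.toReal ^ (q - 1))) ^ (1 / q) := by gcongr
      _ = _ := by
        rw [ENNReal.ofReal_rpow_of_nonneg (by positivity) (by positivity),
          Real.mul_rpow hCpos.le (by positivity), ← Real.rpow_mul hN.le, hqp,
          ENNReal.ofReal_mul (by positivity), ← ENNReal.ofReal_rpow_of_nonneg hN.le (by positivity),
          ENNReal.ofReal_toReal hMt]

/-! ### Balls, power weights and the low-frequency estimate -/

theorem continuous_euclLength (d : ℕ) : Continuous (euclLength (d := d)) := by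
  unfold euclLength; fun_prop

theorem euclLength_nonneg {d : ℕ} (x : WeinsteinSpace d) : 0 ≤ euclLength x := Real.sqrt_nonneg _

theorem ae_euclLength_pos (d : ℕ) (α : ℝ) : ∀ᵐ x ∂weinsteinMeasure d α, 0 < euclLength x := by
  have h : ∀ᵐ x ∂(volume.restrict {x : WeinsteinSpace d | 0 < x.2}), 0 < euclLength x := by
    filter_upwards [ae_restrict_mem (measurableSet_lt measurable_const measurable_snd)] with x hx
    have hx : 0 < x.2 := hx
    unfold euclLength
    positivity
  exact (withDensity_absolutelyContinuous _ _).ae_le h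

theorem measurableSet_euclLength_le (d : ℕ) (R : ℝ) :
    MeasurableSet {x : WeinsteinSpace d | euclLength x ≤ R} :=
  measurableSet_le (continuous_euclLength d).measurable measurable_const

/-- The ball lies in a cylinder, whose measure is a multiple of R^d · R^(2α+2). An upper bound
suffices. -/
theorem exists_weinsteinMeasure_ball_le (d : ℕ) {α : ℝ} (hα : -1 < α) :
    ∃ V : ℝ, 0 < V ∧ ∀ R : ℝ, 0 < R →
      weinsteinMeasure d α {x | euclLength x ≤ R} ≤ ENNReal.ofReal (V * R ^ (2 * α + d + 2)) := by
  have hc := weinsteinConst_pos d hα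
  set c := weinsteinConst d α
  set v : ℝ := (volume (Metric.ball (0 : EuclideanSpace ℝ (Fin d)) 1)).toReal
  have hvt : volume (Metric.ball (0 : EuclideanSpace ℝ (Fin d)) 1) ≠ ⊤ := measure_ball_lt_top.ne
  have hv : 0 < v := ENNReal.toReal_pos (Metric.measure_ball_pos _ _ one_pos).ne' hvt
  have hα2 : 0 < 2 * α + 2 := by linarith
  refine ⟨v * (c⁻¹ * (2 * α + 2)⁻¹), by positivity, fun R hR => ?_⟩
  have hsub : {x : WeinsteinSpace d | euclLength x ≤ R} ⊆ Metric.closedBall 0 R ×ˢ Set.Iic R := by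
    intro x hx
    have hx : euclLength x ≤ R := hx
    have h1 : Real.sqrt (‖x.1‖ ^ 2) ≤ euclLength x :=
      Real.sqrt_le_sqrt (by have := sq_nonneg x.2; linarith)
    have h2 : Real.sqrt (x.2 ^ 2) ≤ euclLength x :=
      Real.sqrt_le_sqrt (by have := sq_nonneg ‖x.1‖; linarith)
    rw [Real.sqrt_sq (norm_nonneg _)] at h1
    rw [Real.sqrt_sq_eq_abs] at h2
    refine ⟨?_, ?_⟩
    · rw [mem_closedBall_zero_iff]; linarith
    · exact (le_abs_self _).trans (h2.trans hx)
  have hrad : besselMeasure c α (Set.Iic R) =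
      ENNReal.ofReal (c⁻¹ * (R ^ (2 * α + 2) / (2 * α + 2))) := by
    rw [← lintegral_indicator_one measurableSet_Iic, lintegral_besselMeasure]
    have e : ∀ x : ℝ, ENNReal.ofReal (x ^ (2 * α + 1) / c) * (Set.Iic R).indicator 1 x =
        ENNReal.ofReal c⁻¹ * {t : ℝ | t * 1 ≤ R}.indicator
          (fun t => ENNReal.ofReal (t ^ (2 * α + 1))) x := by
      intro x
      by_cases hx : x ≤ R
      · rw [Set.indicator_of_mem (by simpa using hx), Set.indicator_of_mem (by simpa using hx),
          ← ENNReal.ofReal_mul (by positivity), div_eq_inv_mul]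
        simp
      · rw [Set.indicator_of_notMem (by simpa using hx), Set.indicator_of_notMem (by simpa using hx)]
        simp
    simp only [e]
    rw [lintegral_const_mul' _ _ ENNReal.ofReal_ne_top,
      lintegral_indicator_rpow_mul_le (by linarith) one_pos hR, ← ENNReal.ofReal_mul (by positivity),
      div_one, show 2 * α + 1 + 1 = 2 * α + 2 by ring]
  calc weinsteinMeasure d α {x | euclLength x ≤ R}
      ≤ weinsteinMeasure d α (Metric.closedBall 0 R ×ˢ Set.Iic R) := measure_mono hsub
    _ = _ := by
      rw [weinsteinMeasure_eq_prod, Measure.prod_prod, hrad, Measure.addHaar_closedBall _ _ hR.le,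
        finrank_euclideanSpace_fin, ← ENNReal.ofReal_toReal hvt,
        ← ENNReal.ofReal_mul (by positivity), ← ENNReal.ofReal_mul (by positivity)]
      congr 1
      rw [show 2 * α + d + 2 = (2 * α + 2) + d by ring, Real.rpow_add hR (2 * α + 2),
        Real.rpow_natCast]
      simp only [v]
      ring

/-- Layer cake for |x|^(-a), split at height 1/R: below it the superlevel set is bounded by the
whole ball, above it by the ball of radius 1/t. The two integrals converge because a > 0 and a <
2α+d+2 respectively. -/
theorem exists_setLIntegral_euclLength_rpow_neg_le (d : ℕ) {α a : ℝ} (hα : -1 < α) (ha : 0 < a)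
    (ha' : a < 2 * α + d + 2) :
    ∃ V : ℝ, 0 < V ∧ ∀ R : ℝ, 0 < R →
      ∫⁻ x in {x | euclLength x ≤ R}, ENNReal.ofReal (euclLength x ^ (-a)) ∂weinsteinMeasure d α ≤
        ENNReal.ofReal (V * R ^ (2 * α + d + 2 - a)) := by
  obtain ⟨V, hV, hball⟩ := exists_weinsteinMeasure_ball_le d hα
  set Q : ℝ := 2 * α + d + 2
  have hQa : 0 < Q - a := by linarith
  refine ⟨a * V * (a⁻¹ + (Q - a)⁻¹), by positivity, fun R hR => ?_⟩
  set μ := weinsteinMeasure d α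
  set B : Set (WeinsteinSpace d) := {x | euclLength x ≤ R}
  have hR1 : 0 < R⁻¹ := by positivity
  have e : ∀ x : WeinsteinSpace d, euclLength x ^ (-a) = ((euclLength x)⁻¹) ^ a := fun x => by
    rw [Real.rpow_neg (euclLength_nonneg x), Real.inv_rpow (euclLength_nonneg x)]
  simp only [e]
  rw [lintegral_rpow_eq_lintegral_meas_lt_mul _
    (ae_of_all _ fun x => inv_nonneg.2 (euclLength_nonneg x))
    (continuous_euclLength d).measurable.inv.aemeasurable ha,
    ← Set.Ioc_union_Ioi_eq_Ioi hR1.le,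
    lintegral_union measurableSet_Ioi (Set.Ioc_disjoint_Ioi le_rfl)]
  have hlow : ∫⁻ t in Set.Ioc 0 R⁻¹, (μ.restrict B) {x | t < (euclLength x)⁻¹} *
      ENNReal.ofReal (t ^ (a - 1)) ≤ ENNReal.ofReal (V * a⁻¹ * R ^ (Q - a)) := by
    have hint := intervalIntegral.intervalIntegrable_rpow' (a := 0) (b := R⁻¹)
      (show -1 < a - 1 by linarith)
    rw [intervalIntegrable_iff_integrableOn_Ioc_of_le hR1.le] at hint
    calc _ ≤ ∫⁻ t in Set.Ioc 0 R⁻¹, ENNReal.ofReal (V * R ^ Q) * ENNReal.ofReal (t ^ (a - 1)) := by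
          refine lintegral_mono fun t => ?_
          refine mul_le_mul_left ?_ _
          refine (measure_mono (Set.subset_univ _)).trans ?_
          rw [Measure.restrict_apply_univ]
          exact hball R hR
      _ = _ := by
          rw [lintegral_const_mul' _ _ ENNReal.ofReal_ne_top, ← ofReal_integral_eq_lintegral_ofReal
            hint (by
              filter_upwards [ae_restrict_mem measurableSet_Ioc] with t ht
              exact Real.rpow_nonneg ht.1.le _), ← intervalIntegral.integral_of_le hR1.le,
            integral_rpow (Or.inl (by linarith)), sub_add_cancel, Real.zero_rpow ha.ne', sub_zero,
            ← ENNReal.ofReal_mul (by positivity), Real.inv_rpow hR.le, Real.rpow_sub hR]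
          congr 1
          field_simp
  have hhigh : ∫⁻ t in Set.Ioi R⁻¹, (μ.restrict B) {x | t < (euclLength x)⁻¹} *
      ENNReal.ofReal (t ^ (a - 1)) ≤ ENNReal.ofReal (V * (Q - a)⁻¹ * R ^ (Q - a)) := by
    have hlt : a - 1 - Q < -1 := by linarith
    have hint := integrableOn_Ioi_rpow_of_lt hlt hR1
    calc _ ≤ ∫⁻ t in Set.Ioi R⁻¹, ENNReal.ofReal V * ENNReal.ofReal (t ^ (a - 1 - Q)) := by
          refine setLIntegral_mono' measurableSet_Ioi fun t ht => ?_
          have ht0 : 0 < t := hR1.trans ht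
          have hsub : {x : WeinsteinSpace d | t < (euclLength x)⁻¹} ⊆
              {x | euclLength x ≤ t⁻¹} := by
            intro x hx
            have hx : t < (euclLength x)⁻¹ := hx
            have hpos : 0 < euclLength x := inv_pos.1 (ht0.trans hx)
            exact (le_inv_comm₀ ht0 hpos).1 hx.le
          calc _ ≤ μ {x | euclLength x ≤ t⁻¹} * ENNReal.ofReal (t ^ (a - 1)) := by
                refine mul_le_mul_left ?_ _
                exact (Measure.restrict_apply_le _ _).trans (measure_mono hsub)
            _ ≤ ENNReal.ofReal (V * t⁻¹ ^ Q) * ENNReal.ofReal (t ^ (a - 1)) :=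
                mul_le_mul_left (hball _ (by positivity)) _
            _ = _ := by
                rw [← ENNReal.ofReal_mul (by positivity), ← ENNReal.ofReal_mul hV.le,
                  Real.rpow_sub ht0 (a - 1) Q, Real.inv_rpow ht0.le]
                congr 1
                field_simp
      _ = _ := by
          rw [lintegral_const_mul' _ _ ENNReal.ofReal_ne_top, ← ofReal_integral_eq_lintegral_ofReal
            hint (by
              filter_upwards [ae_restrict_mem measurableSet_Ioi] with t ht
              exact Real.rpow_nonneg (hR1.trans ht).le _), integral_Ioi_rpow_of_lt hlt hR1,
            ← ENNReal.ofReal_mul hV.le]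
          congr 1
          rw [show a - 1 - Q + 1 = -(Q - a) by ring, Real.inv_rpow hR.le, Real.rpow_neg hR.le,
            inv_inv, neg_div_neg_eq]
          ring
  calc _ ≤ ENNReal.ofReal a * (ENNReal.ofReal (V * a⁻¹ * R ^ (Q - a)) +
        ENNReal.ofReal (V * (Q - a)⁻¹ * R ^ (Q - a))) := by gcongr
    _ = _ := by
        rw [← ENNReal.ofReal_add (by positivity) (by positivity), ← ENNReal.ofReal_mul ha.le]
        congr 1
        ring

theorem eLpNorm_restrict_compl_add {X : Type*} [MeasurableSpace X] {μ : Measure X} {r : ENNReal}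
    (hr : 1 ≤ r) {S : Set X} (hS : MeasurableSet S) {f : X → ℂ} (hf : AEStronglyMeasurable f μ) :
    eLpNorm f r μ ≤ eLpNorm f r (μ.restrict S) + eLpNorm f r (μ.restrict Sᶜ) := by
  rw [← eLpNorm_indicator_eq_eLpNorm_restrict hS,
    ← eLpNorm_indicator_eq_eLpNorm_restrict hS.compl]
  refine le_trans (le_of_eq ?_) (eLpNorm_add_le (hf.indicator hS) (hf.indicator hS.compl) hr)
  rw [Set.indicator_self_add_compl]

theorem memLp_one_indicator_ball {d : ℕ} {α p : ℝ} (hα : -1 < α) (hp : 1 < p) {R : ℝ} (hR : 0 < R)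
    {φ : WeinsteinSpace d → ℂ} (hφ : MemLp φ (ENNReal.ofReal p) (weinsteinMeasure d α)) :
    MemLp ({x | euclLength x ≤ R}.indicator φ) 1 (weinsteinMeasure d α) := by
  obtain ⟨V, hV, hball⟩ := exists_weinsteinMeasure_ball_le d hα
  rw [memLp_indicator_iff_restrict (measurableSet_euclLength_le d R)]
  have : IsFiniteMeasure ((weinsteinMeasure d α).restrict {x | euclLength x ≤ R}) :=
    ⟨by rw [Measure.restrict_apply_univ]; exact (hball R hR).trans_lt ENNReal.ofReal_lt_top⟩
  exact (hφ.restrict _).mono_exponent (by simpa using hp.le)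

/-- Hölder applied to u = |x|^(-s) · |x|^s u; the condition on s makes |x|^(-sq) integrable near the
origin. -/
theorem exists_lintegral_enorm_indicator_ball_le (d : ℕ) {α p q s : ℝ} (hα : -1 < α)
    (hpq : p.HolderConjugate q) (hs : 0 < s) (hs' : s * q < 2 * α + d + 2) :
    ∃ V : ℝ, 0 < V ∧ ∀ R : ℝ, 0 < R → ∀ u : WeinsteinSpace d → ℂ,
      AEStronglyMeasurable u (weinsteinMeasure d α) →
      ∫⁻ x, ‖{x | euclLength x ≤ R}.indicator u x‖ₑ ∂weinsteinMeasure d α ≤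
        ENNReal.ofReal (V * R ^ ((2 * α + d + 2) / q - s)) *
        eLpNorm (fun x => ((euclLength x ^ s : ℝ) : ℂ) * u x) (ENNReal.ofReal p)
          (weinsteinMeasure d α) := by
  have hq0 : 0 < q := hpq.symm.pos
  have hp0 : 0 < p := hpq.pos
  obtain ⟨V, hV, hint⟩ := exists_setLIntegral_euclLength_rpow_neg_le d hα (mul_pos hs hq0) hs'
  refine ⟨V ^ (1 / q), by positivity, fun R hR u hu => ?_⟩
  set μ := weinsteinMeasure d α
  set B : Set (WeinsteinSpace d) := {x | euclLength x ≤ R}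
  have hB : MeasurableSet B := measurableSet_euclLength_le d R
  have hlen : Measurable (euclLength (d := d)) := (continuous_euclLength d).measurable
  set f : WeinsteinSpace d → ENNReal := fun x => ‖((euclLength x ^ s : ℝ) : ℂ) * u x‖ₑ
  set g : WeinsteinSpace d → ENNReal := fun x => ENNReal.ofReal (euclLength x ^ (-s))
  have hf : AEMeasurable f μ := by
    have h1 : Measurable fun x : WeinsteinSpace d => ((euclLength x ^ s : ℝ) : ℂ) := by fun_prop
    exact (h1.aestronglyMeasurable.mul hu).enorm
  have hg : Measurable g := by fun_prop
  have e1 : ∫⁻ x, ‖B.indicator u x‖ₑ ∂μ = ∫⁻ x in B, (f * g) x ∂μ := by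
    rw [← lintegral_indicator hB]
    refine lintegral_congr_ae ?_
    filter_upwards [ae_euclLength_pos d α] with x hx
    by_cases hxB : x ∈ B
    · rw [Set.indicator_of_mem hxB, Set.indicator_of_mem hxB]
      simp only [f, g, Pi.mul_apply]
      rw [enorm_mul, ← ofReal_norm ((euclLength x ^ s : ℝ) : ℂ), Complex.norm_real, Real.norm_of_nonneg (by positivity),
        mul_right_comm, ← ENNReal.ofReal_mul (by positivity), ← Real.rpow_add hx]
      simp
    · rw [Set.indicator_of_notMem hxB, Set.indicator_of_notMem hxB]
      simp
  rw [e1]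
  refine (ENNReal.lintegral_mul_le_Lp_mul_Lq _ hpq hf.restrict hg.aemeasurable).trans ?_
  rw [mul_comm]
  have e2 : (∫⁻ x in B, g x ^ q ∂μ) ^ (1 / q) ≤
      ENNReal.ofReal (V ^ (1 / q) * R ^ ((2 * α + d + 2) / q - s)) := by
    calc (∫⁻ x in B, g x ^ q ∂μ) ^ (1 / q)
        ≤ (ENNReal.ofReal (V * R ^ (2 * α + d + 2 - s * q))) ^ (1 / q) := by
          refine ENNReal.rpow_le_rpow (le_trans (le_of_eq ?_) (hint R hR)) (by positivity)
          refine lintegral_congr fun x => ?_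
          simp only [g]
          rw [ENNReal.ofReal_rpow_of_nonneg (Real.rpow_nonneg (euclLength_nonneg x) _) hq0.le,
            ← Real.rpow_mul (euclLength_nonneg x), neg_mul]
      _ = _ := by
          rw [ENNReal.ofReal_rpow_of_nonneg (by positivity) (by positivity),
            Real.mul_rpow hV.le (by positivity), ← Real.rpow_mul hR.le]
          congr 3
          field_simp
  refine mul_le_mul' e2 ?_
  rw [eLpNorm_eq_lintegral_rpow_enorm_toReal (by simpa using hp0) ENNReal.ofReal_ne_top,
    ENNReal.toReal_ofReal hp0.le]
  exact ENNReal.rpow_le_rpow (setLIntegral_le_lintegral _ _) (by positivity)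

/-- The low-frequency part of the transform is controlled by the weighted norm of the function. -/
theorem exists_eLpNorm_weinsteinIntegral_restrict_ball_le (d : ℕ) {α p q s : ℝ}
    (hα : -(1 / 2) < α) (hp : 1 < p) (hp2 : p ≤ 2) (hq : q = p / (p - 1)) (hs : 0 < s)
    (hs' : s < (2 * α + d + 2) / q) :
    ∃ C : ℝ, 0 < C ∧ ∀ ρ : ℝ, 0 < ρ → ∀ u : WeinsteinSpace d → ℂ,
      MemLp u 1 (weinsteinMeasure d α) → MemLp u (ENNReal.ofReal p) (weinsteinMeasure d α) →
      eLpNorm (weinsteinIntegral α u) (ENNReal.ofReal q)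
        ((weinsteinMeasure d α).restrict {y | euclLength y ≤ ρ}) ≤
        ENNReal.ofReal (C * ρ ^ s) * eLpNorm (fun x => ((euclLength x ^ s : ℝ) : ℂ) * u x)
          (ENNReal.ofReal p) (weinsteinMeasure d α) := by
  have hα1 : -1 < α := by linarith
  have hpq : p.HolderConjugate q := by
    rw [hq]; exact Real.HolderConjugate.conjExponent hp
  have hq0 : 0 < q := hpq.symm.pos
  have hq1 : 1 < q := hpq.symm.lt
  set Q : ℝ := 2 * α + d + 2
  obtain ⟨C, hC, hHY⟩ := exists_eLpNorm_weinsteinIntegral_le d hα hp hp2 hq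
  obtain ⟨V, hV, hball⟩ := exists_weinsteinMeasure_ball_le d hα1
  obtain ⟨W, hW, hlow⟩ := exists_lintegral_enorm_indicator_ball_le d hα1 hpq hs
    ((lt_div_iff₀ hq0).1 hs')
  refine ⟨V ^ (1 / q) * W + C, by positivity, fun ρ hρ u hu1 hup => ?_⟩
  set μ := weinsteinMeasure d α
  set A := eLpNorm (fun x => ((euclLength x ^ s : ℝ) : ℂ) * u x) (ENNReal.ofReal p) μ
  -- The reciprocal radius makes both pieces scale as ρ^s: the inner one as ρ^(s-Q/q) · ρ^(Q/q), the
  -- outer one through (ρ|x|)^s ≥ 1.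
  set B : Set (WeinsteinSpace d) := {x | euclLength x ≤ ρ⁻¹}
  have hB : MeasurableSet B := measurableSet_euclLength_le d _
  have hb1 : MemLp (B.indicator u) 1 μ := hu1.indicator hB
  have hc1 : MemLp (Bᶜ.indicator u) 1 μ := hu1.indicator hB.compl
  have hcp : MemLp (Bᶜ.indicator u) (ENNReal.ofReal p) μ := hup.indicator hB.compl
  have hsplit : weinsteinIntegral α u =
      weinsteinIntegral α (B.indicator u) + weinsteinIntegral α (Bᶜ.indicator u) := by
    funext y
    rw [Pi.add_apply, ← weinsteinIntegral_add hα (memLp_one_iff_integrable.1 hb1)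
      (memLp_one_iff_integrable.1 hc1), Set.indicator_self_add_compl]
  have hfirst : eLpNorm (weinsteinIntegral α (B.indicator u)) (ENNReal.ofReal q)
      (μ.restrict {y | euclLength y ≤ ρ}) ≤ ENNReal.ofReal (V ^ (1 / q) * W * ρ ^ s) * A := by
    refine (eLpNorm_le_of_ae_enorm_bound (C := ENNReal.ofReal (W * ρ⁻¹ ^ (Q / q - s)) * A)
      (ae_of_all _ fun y => (enorm_weinsteinIntegral_le hα _ y).trans
        (hlow _ (by positivity) u hu1.1))).trans ?_
    rw [Measure.restrict_apply_univ, ENNReal.toReal_ofReal hq0.le, smul_eq_mul]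
    calc ENNReal.ofReal (W * ρ⁻¹ ^ (Q / q - s)) * A * μ {y | euclLength y ≤ ρ} ^ q⁻¹
        ≤ ENNReal.ofReal (W * ρ⁻¹ ^ (Q / q - s)) * A * ENNReal.ofReal (V * ρ ^ Q) ^ q⁻¹ := by
          gcongr
          exact hball ρ hρ
      _ = _ := by
          rw [ENNReal.ofReal_rpow_of_nonneg (by positivity) (by positivity), mul_right_comm,
            ← ENNReal.ofReal_mul (by positivity)]
          congr 2
          rw [Real.mul_rpow hV.le (by positivity), ← Real.rpow_mul hρ.le, Real.inv_rpow hρ.le,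
            ← Real.rpow_neg hρ.le, one_div]
          have : ρ ^ s = ρ ^ (-(Q / q - s)) * ρ ^ (Q * q⁻¹) := by
            rw [← Real.rpow_add hρ]
            congr 1
            rw [div_eq_mul_inv]
            ring
          rw [this]
          ring
  have hsecond : eLpNorm (weinsteinIntegral α (Bᶜ.indicator u)) (ENNReal.ofReal q)
      (μ.restrict {y | euclLength y ≤ ρ}) ≤ ENNReal.ofReal (C * ρ ^ s) * A := by
    refine (eLpNorm_restrict_le _ _ _ _).trans ((hHY _ hc1 hcp).trans ?_)
    rw [ENNReal.ofReal_mul hC.le, mul_assoc]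
    refine mul_le_mul_right ?_ _
    refine eLpNorm_le_mul_eLpNorm_of_ae_le_mul (ae_of_all _ fun x => ?_) _
    by_cases hx : x ∈ Bᶜ
    · have hx' : ρ⁻¹ < euclLength x := by simpa [B] using hx
      have hpos : 0 < euclLength x := lt_trans (by positivity) hx'
      rw [Set.indicator_of_mem hx, norm_mul, Complex.norm_real,
        Real.norm_of_nonneg (by positivity), ← mul_assoc, ← Real.mul_rpow hρ.le hpos.le]
      refine le_mul_of_one_le_left (norm_nonneg _) (Real.one_le_rpow ?_ hs.le)
      rw [inv_lt_iff_one_lt_mul₀ hρ] at hx'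
      linarith
    · rw [Set.indicator_of_notMem hx, norm_zero]
      positivity
  have hm : ∀ v : WeinsteinSpace d → ℂ, MemLp v 1 μ → AEStronglyMeasurable (weinsteinIntegral α v)
      (μ.restrict {y | euclLength y ≤ ρ}) := fun v hv =>
    aestronglyMeasurable_weinsteinIntegral hα1 hv.1 _
  rw [hsplit]
  refine (eLpNorm_add_le (hm _ hb1) (hm _ hc1) (by simpa using hq1.le)).trans ?_
  refine (add_le_add hfirst hsecond).trans (le_of_eq ?_)
  rw [← add_mul, ← ENNReal.ofReal_add (by positivity) (by positivity), ← add_mul]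

/-- Optimisation of a two-term bound over the cut-off radius. -/
theorem le_mul_rpow_mul_rpow_of_forall_le {s t C : ℝ} (hs : 0 < s) (ht : 0 < t) (hC : 0 < C)
    {N A B : ENNReal} (hA : A = 0 → N = 0) (hB : B = 0 → N = 0)
    (h : ∀ ρ : ℝ, 0 < ρ → N ≤ ENNReal.ofReal (C * ρ ^ s) * A + ENNReal.ofReal (ρ ^ (-t)) * B) :
    N ≤ ENNReal.ofReal (C + 1) * A ^ (t / (s + t)) * B ^ (s / (s + t)) := by
  have hst : 0 < s + t := by linarith
  have hs1 : 0 < s / (s + t) := by positivity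
  have ht1 : 0 < t / (s + t) := by positivity
  have hC1 : ENNReal.ofReal (C + 1) ≠ 0 := by
    simp only [ne_eq, ENNReal.ofReal_eq_zero, not_le]; positivity
  -- When A or B vanishes the right side is 0 even if the other is infinite, so N = 0 has to be
  -- known beforehand.
  rcases eq_or_ne A 0 with hA0 | hA0
  · rw [hA hA0]; exact zero_le
  rcases eq_or_ne B 0 with hB0 | hB0
  · rw [hB hB0]; exact zero_le
  have hA1 : A ^ (t / (s + t)) ≠ 0 := by
    simp only [ne_eq, ENNReal.rpow_eq_zero_iff, not_or, not_and]
    exact ⟨fun h => absurd h hA0, fun _ => ht1.le.not_gt⟩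
  have hB1 : B ^ (s / (s + t)) ≠ 0 := by
    simp only [ne_eq, ENNReal.rpow_eq_zero_iff, not_or, not_and]
    exact ⟨fun h => absurd h hB0, fun _ => hs1.le.not_gt⟩
  rcases eq_or_ne A ⊤ with hAt | hAt
  · rw [hAt, ENNReal.top_rpow_of_pos ht1, ENNReal.mul_top hC1, ENNReal.top_mul hB1]
    exact le_top
  rcases eq_or_ne B ⊤ with hBt | hBt
  · rw [hBt, ENNReal.top_rpow_of_pos hs1, ENNReal.mul_top (mul_ne_zero hC1 hA1)]
    exact le_top
  have ha : 0 < A.toReal := ENNReal.toReal_pos hA0 hAt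
  have hb : 0 < B.toReal := ENNReal.toReal_pos hB0 hBt
  rw [← ENNReal.ofReal_toReal hAt, ← ENNReal.ofReal_toReal hBt] at h ⊢
  set a := A.toReal
  set b := B.toReal
  -- This ρ solves ρ^s a = ρ^(-t) b; both sides equal a^(t/(s+t)) b^(s/(s+t)), whence the constant C
  -- + 1.
  refine (h ((b / a) ^ (1 / (s + t))) (by positivity)).trans (le_of_eq ?_)
  rw [ENNReal.ofReal_rpow_of_nonneg ha.le ht1.le, ENNReal.ofReal_rpow_of_nonneg hb.le hs1.le,
    ← ENNReal.ofReal_mul (by positivity), ← ENNReal.ofReal_mul (by positivity),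
    ← ENNReal.ofReal_mul (by positivity), ← ENNReal.ofReal_mul (by positivity),
    ← ENNReal.ofReal_add (by positivity) (by positivity)]
  congr 1
  rw [← Real.rpow_mul (by positivity), ← Real.rpow_mul (by positivity),
    Real.div_rpow hb.le ha.le, Real.div_rpow hb.le ha.le]
  have e1 : 1 / (s + t) * s = s / (s + t) := by ring
  have e2 : 1 / (s + t) * -t = -(t / (s + t)) := by ring
  have e3 : a = a ^ (t / (s + t)) * a ^ (s / (s + t)) := by
    rw [← Real.rpow_add ha, ← add_div, add_comm t s, div_self hst.ne', Real.rpow_one]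
  have e4 : b = b ^ (t / (s + t)) * b ^ (s / (s + t)) := by
    rw [← Real.rpow_add hb, ← add_div, add_comm t s, div_self hst.ne', Real.rpow_one]
  rw [e1, e2, Real.rpow_neg hb.le, Real.rpow_neg ha.le]
  nth_rewrite 2 [e3]
  nth_rewrite 3 [e4]
  have := Real.rpow_pos_of_pos ha (s / (s + t))
  have := Real.rpow_pos_of_pos ha (t / (s + t))
  have := Real.rpow_pos_of_pos hb (t / (s + t))
  field_simp

/-! ### Extension by density -/

/-- Truncation to growing balls, by dominated convergence. The pointwise bound by φ is kept because
it carries over to the weighted norm, whose finiteness is not assumed. -/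
theorem exists_tendsto_eLpNorm_truncation {d : ℕ} {α p : ℝ} (hα : -1 < α) (hp : 1 < p)
    {φ : WeinsteinSpace d → ℂ} (hφ : MemLp φ (ENNReal.ofReal p) (weinsteinMeasure d α)) :
    ∃ u : ℕ → WeinsteinSpace d → ℂ,
      (∀ n, MemLp (u n) 1 (weinsteinMeasure d α)) ∧
      (∀ n, MemLp (u n) (ENNReal.ofReal p) (weinsteinMeasure d α)) ∧
      (∀ n x, ‖u n x‖ ≤ ‖φ x‖) ∧
      Tendsto (fun n => eLpNorm (fun x => u n x - φ x) (ENNReal.ofReal p) (weinsteinMeasure d α))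
        atTop (𝓝 0) := by
  have hp0 : 0 < p := by linarith
  set μ := weinsteinMeasure d α
  let B : ℕ → Set (WeinsteinSpace d) := fun n => {x | euclLength x ≤ n + 1}
  have hB : ∀ n, MeasurableSet (B n) := fun n => measurableSet_euclLength_le d _
  have hbd : ∀ n x, ‖(B n).indicator φ x‖ ≤ ‖φ x‖ := fun n x => norm_indicator_le_norm_self _ _
  have hbd' : ∀ n x, ‖(B n).indicator φ x - φ x‖ ≤ ‖φ x‖ := fun n x => by
    by_cases hx : x ∈ B n
    · simp [Set.indicator_of_mem hx]
    · simp [Set.indicator_of_notMem hx]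
  refine ⟨fun n => (B n).indicator φ, fun n => memLp_one_indicator_ball hα hp (by positivity) hφ,
    fun n => hφ.indicator (hB n), hbd, ?_⟩
  simp only [eLpNorm_ofReal_eq hp0]
  have hfin : ∫⁻ x, ENNReal.ofReal (‖φ x‖ ^ p) ∂μ ≠ ⊤ := by
    intro h
    have := hφ.2
    rw [eLpNorm_ofReal_eq hp0, h, ENNReal.top_rpow_of_pos (by positivity)] at this
    exact lt_irrefl _ this
  have hlim : Tendsto (fun n => ∫⁻ x, ENNReal.ofReal (‖(B n).indicator φ x - φ x‖ ^ p) ∂μ) atTop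
      (𝓝 (∫⁻ _, 0 ∂μ)) := by
    refine tendsto_lintegral_of_dominated_convergence'
      (fun x => ENNReal.ofReal (‖φ x‖ ^ p)) (fun n => ?_) (fun n => ae_of_all _ fun x => ?_)
      hfin (ae_of_all _ fun x => ?_)
    · exact ((((hφ.1.indicator (hB n)).sub hφ.1).norm.aemeasurable).pow_const p).ennreal_ofReal
    · exact ENNReal.ofReal_le_ofReal
        (Real.rpow_le_rpow (norm_nonneg _) (hbd' n x) hp0.le)
    · refine tendsto_const_nhds.congr' ?_
      obtain ⟨m, hm⟩ := exists_nat_ge (euclLength x)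
      filter_upwards [eventually_ge_atTop m] with n hn
      have hx : x ∈ B n := by
        have : (m : ℝ) ≤ n := by exact_mod_cast hn
        change euclLength x ≤ n + 1
        linarith
      simp [Set.indicator_of_mem hx, Real.zero_rpow hp0.ne']
  rw [lintegral_zero] at hlim
  have := (ENNReal.continuous_rpow_const (y := 1 / p)).tendsto 0 |>.comp hlim
  rwa [ENNReal.zero_rpow_of_pos (by positivity)] at this

theorem eLpNorm_weinsteinIntegral_sub_le {d : ℕ} {α p q C : ℝ} (hα : -(1 / 2) < α)
    (hHY : ∀ u : WeinsteinSpace d → ℂ, MemLp u 1 (weinsteinMeasure d α) →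
      MemLp u (ENNReal.ofReal p) (weinsteinMeasure d α) →
      eLpNorm (weinsteinIntegral α u) (ENNReal.ofReal q) (weinsteinMeasure d α) ≤
        ENNReal.ofReal C * eLpNorm u (ENNReal.ofReal p) (weinsteinMeasure d α))
    {u v : WeinsteinSpace d → ℂ} (hu : MemLp u 1 (weinsteinMeasure d α))
    (hu' : MemLp u (ENNReal.ofReal p) (weinsteinMeasure d α))
    (hv : MemLp v 1 (weinsteinMeasure d α))
    (hv' : MemLp v (ENNReal.ofReal p) (weinsteinMeasure d α)) :
    eLpNorm (weinsteinIntegral α u - weinsteinIntegral α v) (ENNReal.ofReal q)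
      (weinsteinMeasure d α) ≤
      ENNReal.ofReal C * eLpNorm (u - v) (ENNReal.ofReal p) (weinsteinMeasure d α) := by
  have h := hHY _ (hu.sub hv) (hu'.sub hv')
  have e : weinsteinIntegral α (u - v) = weinsteinIntegral α u - weinsteinIntegral α v :=
    funext fun l => weinsteinIntegral_sub hα (memLp_one_iff_integrable.1 hu)
      (memLp_one_iff_integrable.1 hv) l
  rwa [e] at h

/-- The transforms of an `L^p`-convergent sequence in `L^1 ∩ L^p` converge in `L^q`. -/
theorem exists_tendsto_eLpNorm_weinsteinIntegral {d : ℕ} {α p q C : ℝ} (hα : -(1 / 2) < α)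
    (hp : 1 ≤ p) (hq : 1 ≤ q)
    (hHY : ∀ u : WeinsteinSpace d → ℂ, MemLp u 1 (weinsteinMeasure d α) →
      MemLp u (ENNReal.ofReal p) (weinsteinMeasure d α) →
      eLpNorm (weinsteinIntegral α u) (ENNReal.ofReal q) (weinsteinMeasure d α) ≤
        ENNReal.ofReal C * eLpNorm u (ENNReal.ofReal p) (weinsteinMeasure d α))
    {φ : WeinsteinSpace d → ℂ} (hφ : MemLp φ (ENNReal.ofReal p) (weinsteinMeasure d α))
    {u : ℕ → WeinsteinSpace d → ℂ} (hu1 : ∀ n, MemLp (u n) 1 (weinsteinMeasure d α))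
    (hup : ∀ n, MemLp (u n) (ENNReal.ofReal p) (weinsteinMeasure d α))
    (hlim : Tendsto (fun n => eLpNorm (fun x => u n x - φ x) (ENNReal.ofReal p)
      (weinsteinMeasure d α)) atTop (𝓝 0)) :
    ∃ ψ : WeinsteinSpace d → ℂ, MemLp ψ (ENNReal.ofReal q) (weinsteinMeasure d α) ∧
      Tendsto (fun n => eLpNorm (fun y => weinsteinIntegral α (u n) y - ψ y)
        (ENNReal.ofReal q) (weinsteinMeasure d α)) atTop (𝓝 0) := by
  set μ := weinsteinMeasure d α
  have : Fact (1 ≤ ENNReal.ofReal p) := ⟨by simpa using hp⟩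
  have : Fact (1 ≤ ENNReal.ofReal q) := ⟨by simpa using hq⟩
  have hF : ∀ n, MemLp (weinsteinIntegral α (u n)) (ENNReal.ofReal q) μ := fun n =>
    ⟨aestronglyMeasurable_weinsteinIntegral (by linarith) (hu1 n).1 μ,
      (hHY _ (hu1 n) (hup n)).trans_lt (ENNReal.mul_lt_top ENNReal.ofReal_lt_top (hup n).2)⟩
  have hcu : CauchySeq fun n => (hup n).toLp (u n) :=
    ((Lp.tendsto_Lp_iff_tendsto_eLpNorm'' u hup φ hφ).2 hlim).cauchySeq
  have hcF : CauchySeq fun n => (hF n).toLp (weinsteinIntegral α (u n)) := by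
    rw [EMetric.cauchySeq_iff] at hcu ⊢
    intro ε hε
    -- Adding 1 allows division even if `ENNReal.ofReal C` is 0.
    have hC : ENNReal.ofReal C + 1 ≠ 0 := by simp
    have hCt : ENNReal.ofReal C + 1 ≠ ⊤ := by simp
    obtain ⟨M, hM⟩ := hcu (ε / (ENNReal.ofReal C + 1)) (ENNReal.div_pos hε.ne' hCt)
    refine ⟨M, fun m hm n hn => ?_⟩
    have h := hM m hm n hn
    rw [Lp.edist_toLp_toLp] at h ⊢
    refine (eLpNorm_weinsteinIntegral_sub_le hα hHY (hu1 m) (hup m) (hu1 n) (hup n)).trans_lt ?_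
    calc ENNReal.ofReal C * eLpNorm (u m - u n) (ENNReal.ofReal p) μ
        ≤ (ENNReal.ofReal C + 1) * eLpNorm (u m - u n) (ENNReal.ofReal p) μ := by
          gcongr; exact le_self_add
      _ < (ENNReal.ofReal C + 1) * (ε / (ENNReal.ofReal C + 1)) :=
          (ENNReal.mul_lt_mul_iff_right hC hCt).2 h
      _ = ε := ENNReal.mul_div_cancel hC hCt
  obtain ⟨ψ, hψ⟩ := cauchySeq_tendsto_of_complete hcF
  refine ⟨ψ, Lp.memLp ψ, ?_⟩
  have h := (Lp.tendsto_Lp_iff_tendsto_eLpNorm'' (fun n => weinsteinIntegral α (u n)) hF ψ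
    (Lp.memLp ψ)).1 (by rwa [Lp.toLp_coeFn])
  exact h

/-- Two approximating sequences approach each other in L^p, so by linearity and Hausdorff–Young
their transforms do so in L^q, and the limits agree. -/
theorem IsWeinsteinTransform.ae_eq {d : ℕ} {α p q C : ℝ} (hα : -(1 / 2) < α)
    (hp : 1 ≤ p) (hq : 1 ≤ q)
    (hHY : ∀ u : WeinsteinSpace d → ℂ, MemLp u 1 (weinsteinMeasure d α) →
      MemLp u (ENNReal.ofReal p) (weinsteinMeasure d α) →
      eLpNorm (weinsteinIntegral α u) (ENNReal.ofReal q) (weinsteinMeasure d α) ≤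
        ENNReal.ofReal C * eLpNorm u (ENNReal.ofReal p) (weinsteinMeasure d α))
    {φ ψ ψ' : WeinsteinSpace d → ℂ} (hψ : IsWeinsteinTransform α p q φ ψ)
    (hψ' : IsWeinsteinTransform α p q φ ψ') : ψ' =ᵐ[weinsteinMeasure d α] ψ := by
  obtain ⟨hφ, hψq, u, hu, hulim, huF⟩ := hψ
  obtain ⟨-, hψq', v, hv, hvlim, hvF⟩ := hψ'
  set μ := weinsteinMeasure d α
  have hp' : 1 ≤ ENNReal.ofReal p := by simpa using hp
  have hq' : 1 ≤ ENNReal.ofReal q := by simpa using hq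
  have hm : ∀ w : WeinsteinSpace d → ℂ, MemLp w 1 μ →
      AEStronglyMeasurable (weinsteinIntegral α w) μ := fun w hw =>
    aestronglyMeasurable_weinsteinIntegral (by linarith) hw.1 μ
  have hbound : ∀ n, eLpNorm (ψ' - ψ) (ENNReal.ofReal q) μ ≤
      eLpNorm (fun y => weinsteinIntegral α (v n) y - ψ' y) (ENNReal.ofReal q) μ +
      (ENNReal.ofReal C * (eLpNorm (fun x => v n x - φ x) (ENNReal.ofReal p) μ +
        eLpNorm (fun x => u n x - φ x) (ENNReal.ofReal p) μ) +
      eLpNorm (fun y => weinsteinIntegral α (u n) y - ψ y) (ENNReal.ofReal q) μ) := by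
    intro n
    have e : ψ' - ψ = (ψ' - weinsteinIntegral α (v n)) +
        ((weinsteinIntegral α (v n) - weinsteinIntegral α (u n)) +
          (weinsteinIntegral α (u n) - ψ)) := by abel
    have e2 : v n - u n = (v n - φ) - (u n - φ) := by abel
    rw [e]
    refine (eLpNorm_add_le (hψq'.1.sub (hm _ (hv n).1)) (((hm _ (hv n).1).sub (hm _ (hu n).1)).add
      ((hm _ (hu n).1).sub hψq.1)) hq').trans ?_
    refine add_le_add (le_of_eq (eLpNorm_sub_comm _ _ _ _)) ?_
    refine (eLpNorm_add_le ((hm _ (hv n).1).sub (hm _ (hu n).1))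
      ((hm _ (hu n).1).sub hψq.1) hq').trans ?_
    refine add_le_add ?_ le_rfl
    refine (eLpNorm_weinsteinIntegral_sub_le hα hHY (hv n).1 (hv n).2 (hu n).1 (hu n).2).trans ?_
    refine mul_le_mul_right ?_ _
    rw [e2]
    exact eLpNorm_sub_le ((hv n).2.1.sub hφ.1) ((hu n).2.1.sub hφ.1) hp'
  have hlim := hvF.add ((ENNReal.Tendsto.const_mul (a := ENNReal.ofReal C) (hvlim.add hulim)
    (Or.inr ENNReal.ofReal_ne_top)).add huF)
  simp only [add_zero, mul_zero] at hlim
  have h0 : eLpNorm (ψ' - ψ) (ENNReal.ofReal q) μ = 0 :=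
    le_antisymm (ge_of_tendsto' hlim hbound) zero_le
  rw [eLpNorm_eq_zero_iff (hψq'.1.sub hψq.1) (by simp; linarith)] at h0
  filter_upwards [h0] with x hx
  exact sub_eq_zero.1 hx

end

/-! ### The uncertainty inequality -/

/-- The exponents `p`, `q` are real; all norms take values in `[0, ∞]`, so that nothing is assumed
about the finiteness of the two weighted norms. The constant depends on `d, α, p, s, t` only. -/
theorem theoremA (d : ℕ) (α p q s t : ℝ) (hα : -(1 / 2) < α)
    (hp : 1 < p) (hp2 : p ≤ 2) (hq : q = p / (p - 1))
    (hs : 0 < s) (hs' : s < (2 * α + (d : ℝ) + 2) / q) (ht : 0 < t) :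
    ∃ K : ℝ, 0 < K ∧
      ∀ φ : WeinsteinSpace d → ℂ, MemLp φ (ENNReal.ofReal p) (weinsteinMeasure d α) →
        ∃ ψ : WeinsteinSpace d → ℂ,
          IsWeinsteinTransform α p q φ ψ ∧
          (∀ ψ' : WeinsteinSpace d → ℂ, IsWeinsteinTransform α p q φ ψ' →
            ψ' =ᵐ[weinsteinMeasure d α] ψ) ∧
          eLpNorm ψ (ENNReal.ofReal q) (weinsteinMeasure d α) ≤
            ENNReal.ofReal K *
              (eLpNorm (fun x => ((euclLength x ^ s : ℝ) : ℂ) * φ x)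
                (ENNReal.ofReal p) (weinsteinMeasure d α)) ^ (t / (s + t)) *
              (eLpNorm (fun y => ((euclLength y ^ t : ℝ) : ℂ) * ψ y)
                (ENNReal.ofReal q) (weinsteinMeasure d α)) ^ (s / (s + t)) := by
  have hα1 : -1 < α := by linarith
  have hpq : p.HolderConjugate q := by
    rw [hq]; exact Real.HolderConjugate.conjExponent hp
  have hq1 : 1 < q := hpq.symm.lt
  have hp' : ENNReal.ofReal p ≠ 0 := by simp; linarith
  have hq' : ENNReal.ofReal q ≠ 0 := by simp; linarith
  have hqle : 1 ≤ ENNReal.ofReal q := by simpa using hq1.le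
  obtain ⟨C, hC, hHY⟩ := exists_eLpNorm_weinsteinIntegral_le d hα hp hp2 hq
  obtain ⟨D, hD, hlow⟩ :=
    exists_eLpNorm_weinsteinIntegral_restrict_ball_le d hα hp hp2 hq hs hs'
  refine ⟨D + 1, by positivity, fun φ hφ => ?_⟩
  obtain ⟨u, hu1, hup, hule, hulim⟩ := exists_tendsto_eLpNorm_truncation hα1 hp hφ
  obtain ⟨ψ, hψ, hFlim⟩ :=
    exists_tendsto_eLpNorm_weinsteinIntegral hα hp.le hq1.le hHY hφ hu1 hup hulim
  have htr : IsWeinsteinTransform α p q φ ψ :=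
    ⟨hφ, hψ, u, fun n => ⟨hu1 n, hup n⟩, hulim, hFlim⟩
  refine ⟨ψ, htr, fun ψ' hψ' => htr.ae_eq hα hp.le hq1.le hHY hψ', ?_⟩
  set μ := weinsteinMeasure d α
  set A := eLpNorm (fun x => ((euclLength x ^ s : ℝ) : ℂ) * φ x) (ENNReal.ofReal p) μ with hA
  set B := eLpNorm (fun y => ((euclLength y ^ t : ℝ) : ℂ) * ψ y) (ENNReal.ofReal q) μ with hB
  have hlen : Measurable (euclLength (d := d)) := (continuous_euclLength d).measurable
  have hm : ∀ n, AEStronglyMeasurable (weinsteinIntegral α (u n)) μ := fun n =>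
    aestronglyMeasurable_weinsteinIntegral hα1 (hu1 n).1 μ
  -- A bound valid for the transforms of all truncations passes to ψ, also on restricted measures,
  -- since L^q(μ) convergence implies L^q(ν) convergence.
  have hlimit : ∀ (ν : Measure (WeinsteinSpace d)) (M : ENNReal), ν ≤ μ →
      (∀ n, eLpNorm (weinsteinIntegral α (u n)) (ENNReal.ofReal q) ν ≤ M) →
      eLpNorm ψ (ENNReal.ofReal q) ν ≤ M := by
    intro ν M hν hM
    have hlim := hFlim.add (tendsto_const_nhds (x := M))
    rw [zero_add] at hlim
    refine ge_of_tendsto' hlim fun n => ?_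
    have e : ψ = (ψ - weinsteinIntegral α (u n)) + weinsteinIntegral α (u n) := by abel
    calc eLpNorm ψ (ENNReal.ofReal q) ν
        ≤ eLpNorm (ψ - weinsteinIntegral α (u n)) (ENNReal.ofReal q) ν +
          eLpNorm (weinsteinIntegral α (u n)) (ENNReal.ofReal q) ν := by
          nth_rewrite 1 [e]
          exact eLpNorm_add_le ((hψ.1.sub (hm n)).mono_measure hν) ((hm n).mono_measure hν) hqle
      _ ≤ _ := by
          refine add_le_add ?_ (hM n)
          refine (eLpNorm_mono_measure _ hν).trans (le_of_eq ?_)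
          exact eLpNorm_sub_comm _ _ _ _
  have hweight : ∀ (r : ℝ) (f : WeinsteinSpace d → ℂ),
      (fun x => ((euclLength x ^ r : ℝ) : ℂ) * f x) =ᵐ[μ] 0 → f =ᵐ[μ] 0 := by
    intro r f h
    filter_upwards [h, ae_euclLength_pos d α] with x hx hpos
    have h0 : ((euclLength x ^ r : ℝ) : ℂ) ≠ 0 :=
      Complex.ofReal_ne_zero.2 (Real.rpow_pos_of_pos hpos r).ne'
    exact (mul_eq_zero.1 hx).resolve_left h0
  have hwm : ∀ (r : ℝ) (f : WeinsteinSpace d → ℂ), AEStronglyMeasurable f μ →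
      AEStronglyMeasurable (fun x => ((euclLength x ^ r : ℝ) : ℂ) * f x) μ := by
    intro r f hf
    have h1 : Measurable fun x : WeinsteinSpace d => ((euclLength x ^ r : ℝ) : ℂ) := by fun_prop
    exact h1.aestronglyMeasurable.mul hf
  refine le_mul_rpow_mul_rpow_of_forall_le hs ht hD ?_ ?_ ?_
  -- The weight is positive almost everywhere, so φ = 0 a.e., and so are the truncations and their
  -- transforms.
  · intro h0
    rw [hA, eLpNorm_eq_zero_iff (hwm s φ hφ.1) hp'] at h0
    have hφ0 := hweight s φ h0
    refine le_antisymm (hlimit μ 0 le_rfl fun n => ?_) zero_le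
    have hle : eLpNorm (u n) (ENNReal.ofReal p) μ ≤ eLpNorm φ (ENNReal.ofReal p) μ :=
      eLpNorm_mono (hule n)
    rw [(eLpNorm_eq_zero_iff hφ.1 hp').2 hφ0] at hle
    refine (hHY _ (hu1 n) (hup n)).trans ?_
    rw [le_antisymm hle zero_le, mul_zero]
  · intro h0
    rw [hB, eLpNorm_eq_zero_iff (hwm t ψ hψ.1) hq'] at h0
    exact (eLpNorm_eq_zero_iff hψ.1 hq').2 (hweight t ψ h0)
  · intro ρ hρ
    have hS := measurableSet_euclLength_le d ρ
    refine (eLpNorm_restrict_compl_add hqle hS hψ.1).trans (add_le_add ?_ ?_)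
    · refine hlimit _ _ Measure.restrict_le_self fun n => ?_
      refine (hlow ρ hρ _ (hu1 n) (hup n)).trans (mul_le_mul_right ?_ _)
      refine eLpNorm_mono fun x => ?_
      rw [norm_mul, norm_mul]
      gcongr
      exact hule n x
    -- High frequencies: where |y| > ρ, the factor (|y|/ρ)^t is at least 1.
    · refine le_trans ?_ (mul_le_mul_right (eLpNorm_restrict_le _ _ _ {y | euclLength y ≤ ρ}ᶜ) _)
      refine eLpNorm_le_mul_eLpNorm_of_ae_le_mul ?_ _
      filter_upwards [ae_restrict_mem hS.compl] with y hy
      have hy : ρ < euclLength y := by simpa using hy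
      have hpos : 0 < euclLength y := hρ.trans hy
      rw [norm_mul, Complex.norm_real, Real.norm_of_nonneg (by positivity), ← mul_assoc,
        Real.rpow_neg hρ.le, ← div_eq_inv_mul]
      refine le_mul_of_one_le_left (norm_nonneg _) ?_
      rw [one_le_div (by positivity)]
      exact Real.rpow_le_rpow hρ.le hy.le ht.le
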